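/- **Setting.** Let $\theta=(\theta_i)_{i\in\iota}\in\mathbb R^{\iota}$ be a finite parameter vector and consider the linear time-invariant system $$x_{t+1}=A(\theta)x_t+B(\theta)u_t+w_t,\qquad y_t=C(\theta)x_t+z_t ,$$ with states in $\mathbb R^{d_x}$, known deterministic inputs in $\mathbb R^{d_u}$, and outputs in $\mathbb R^{N_y}$. The system is in a structured (canonical) form: each entry of $A,B,C$ is either a fixed real number or equal to $\pm\theta_i$ for some $i$. Examples are * the controller form of order $n$ ($d_x=n$, $d_u=N_y=1$): $\theta=(a_1,\dots,a_n,c_1,\dots,c_n)$, $A$ is the companion matrix with ones on the superdiagonal, last row $(-a_n,\dots,-a_1)$ and zeros elsewhere, $B=(0,\dots,0,1)^\top$ is known, $C=(c_1,\dots,c_n)$; * the observer form of order $n$: $\theta=(a_1,\dots,a_n,b_1,\dots,b_n)$, the same $A$, $B=(b_1,\dots,b_n)^\top$, and $C=(1,0,\dots,0)$ fixed. The initial state $x_0\sim\mathcal N(\hat x_0,P_0)$ and the noises $w_t\sim\mathcal N(0,\Sigma)$, $z_t\sim\mathcal N(0,\Gamma)$, $t\ge 0$, are all mutually independent; $\hat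 x_0$, $P_0\succeq0$, $\Sigma\succeq 0$, $\Gamma\succ0$ and the inputs do not depend on $\theta$. Let $T\ge 0$, let $p(y_{1:T}\mid\theta)=\mathbb E\big[\prod_{t=1}^T\mathcal N(y_t;C x_t,\Gamma)\big]$ be the likelihood (latent states marginalized out, expectation over the states under $\theta$), $\mathcal L(\theta)=\mathcal L(\theta;y_{1:T})=\log p(y_{1:T}\mid\theta)$, and let $$I(\theta)=\mathbb E_{Y_{1:T}\mid\theta}\big[\nabla_\theta\mathcal L(\theta;Y_{1:T})\,\nabla_\theta\mathcal L(\theta;Y_{1:T})^\top\big]$$ be the Fisher information matrix. For $t=1,\dots,T$ define the Kalman filter by $\hat x_{0|0}=\hat x_0$, $P_{0|0}=P_0$ and $$\hat x_{t|t-1}=A\hat x_{t-1|t-1}+Bu_{t-1},\quad P_{t|t-1}=AP_{t-1|t-1}A^\top+\Sigma,\quad \nu_t=y_t-C\hat x_{t|t-1},\quad S_t=CP_{t|t-1}C^\top+\Gamma,$$ $$K_t=P_{t|t-1}C^\top S_t^{-1},\quad \hat x_{t|t}=\hat x_{t|t-1}+K_t\nu_t,\quad P_{t|t}=P_{t|t-1}-K_tCP_{t|t-1}.$$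 **Proposition.** For every $T$ and every $\theta$: 1. Each $S_t$ is positive definite, $p(\cdot\mid\theta)$ is the Lebesgue density of the law of $(y_1,\dots,y_T)$ under $\theta$, it is positive everywhere, and for every $y_{1:T}$ $$\mathcal L(\theta)=-\frac{TN_y}{2}\log(2\pi)-\frac12\sum_{t=1}^T\big(\log|S_t|+\nu_t^\top S_t^{-1}\nu_t\big).$$ 2. $\mathcal L$ is differentiable in $\theta$, the score is square integrable under the law of $Y_{1:T}$ given $\theta$, and $$I(\theta)=\sum_{t=1}^T\mathbb E\left[\left(\frac{\partial\nu_t}{\partial\theta}\right)^\top S_t^{-1}\left(\frac{\partial\nu_t}{\partial\theta}\right)+\frac12\left(\frac{\partial\operatorname{vec}S_t}{\partial\theta}\right)^\top\big(S_t^{-1}\otimes S_t^{-1}\big)\left(\frac{\partial\operatorname{vec}S_t}{\partial\theta}\right)\right],$$ where $\partial\nu_t/\partial\theta$ is the Jacobian with the data held fixed, evaluated at $Y_{1:T}$, the expectation is under $\theta$, and all the integrands are integrable. 3. $\nu_t$ and $S_t$ are differentiable in $\theta$, and their partial derivatives are obtained by propagating $\partial_iA,\partial_iB,\partial_iC$ through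 the filter: with $\partial_i\hat x_{0|0}=0$, $\partial_iP_{0|0}=0$, $$\partial_i\hat x_{t|t-1}=(\partial_iA)\hat x_{t-1|t-1}+A\,\partial_i\hat x_{t-1|t-1}+(\partial_iB)u_{t-1},$$ $$\partial_iP_{t|t-1}=(\partial_iA)P_{t-1|t-1}A^\top+A(\partial_iP_{t-1|t-1})A^\top+AP_{t-1|t-1}(\partial_iA)^\top,$$ $$\partial_iS_t=(\partial_iC)P_{t|t-1}C^\top+C(\partial_iP_{t|t-1})C^\top+CP_{t|t-1}(\partial_iC)^\top,\qquad \partial_i\nu_t=-C\,\partial_i\hat x_{t|t-1}-(\partial_iC)\hat x_{t|t-1},$$ $$\partial_iK_t=(\partial_iP_{t|t-1})C^\top S_t^{-1}+P_{t|t-1}(\partial_iC)^\top S_t^{-1}-P_{t|t-1}C^\top S_t^{-1}(\partial_iS_t)S_t^{-1},$$ $$\partial_i\hat x_{t|t}=\partial_i\hat x_{t|t-1}+(\partial_iK_t)\nu_t+K_t\,\partial_i\nu_t,$$ $$\partial_iP_{t|t}=\partial_iP_{t|t-1}-(\partial_iK_t)CP_{t|t-1}-K_t(\partial_iC)P_{t|t-1}-K_tC\,\partial_iP_{t|t-1}.$$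 4. The derivatives of fixed entries of $A,B,C$ vanish. In the controller form $\partial A/\partial a_k$ has the single nonzero entry $-1$ at position $(n,n-k+1)$, $\partial C/\partial c_k$ has the single nonzero entry $1$ at position $(1,k)$, and all other $\partial A,\partial B,\partial C$ are zero; in the observer form $\partial A/\partial a_k$ is the same, $\partial B/\partial b_k$ has the single nonzero entry $1$ at position $(k,1)$, and all others are zero. -/

import Mathlib

open MeasureTheory ProbabilityTheory Matrix
open scoped Kronecker

namespace LTI

/-- An entry of a structured matrix: a fixed real number, or a parameter, or minus a parameter. -/
inductive Entry (ι : Type*) where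
  | fixed (c : ℝ) : Entry ι
  | pos (i : ι) : Entry ι
  | neg (i : ι) : Entry ι

/-- The value of an entry at the parameter vector `θ`. -/
def Entry.eval {ι : Type*} (θ : ι → ℝ) : Entry ι → ℝ
  | .fixed c => c
  | .pos i => θ i
  | .neg i => -θ i

/-- A canonical structure of the system matrices: every entry is either fixed or variable, and the
variable entries are (up to sign) the components of the parameter vector. -/
structure Form (ι : Type*) (dx du dy : ℕ) where
  entryA : Matrix (Fin dx) (Fin dx) (Entry ι)
  entryB : Matrix (Fin dx) (Fin du) (Entry ι)
  entryC : Matrix (Fin dy) (Fin dx) (Entry ι)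

/-- The companion matrix with ones on the superdiagonal and last row `-a_n, …, -a_1`
(component `k` of the vector `a` is `a_{k+1}`, so it stands in the column `n - 1 - k`). -/
def companion {ι : Type*} (n : ℕ) (a : Fin n → ι) : Matrix (Fin n) (Fin n) (Entry ι) :=
  Matrix.of fun i j =>
    if (i : ℕ) + 1 = n then .neg (a j.rev)
    else if (j : ℕ) = (i : ℕ) + 1 then .fixed 1 else .fixed 0

/-- The controller form: `A` is the companion matrix of `a_1, …, a_n`, `B = (0, …, 0, 1)ᵀ` is
known and `C = (c_1, …, c_n)`; the parameter vector is `(a, c)`. -/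
def controllerForm (n : ℕ) : Form (Fin n ⊕ Fin n) n 1 1 where
  entryA := companion n Sum.inl
  entryB := Matrix.of fun i _ => if (i : ℕ) + 1 = n then .fixed 1 else .fixed 0
  entryC := Matrix.of fun _ j => .pos (Sum.inr j)

/-- The observer form: `A` is the companion matrix of `a_1, …, a_n`, `B = (b_1, …, b_n)ᵀ` and
`C = (1, 0, …, 0)` is fixed; the parameter vector is `(a, b)`. -/
def observerForm (n : ℕ) : Form (Fin n ⊕ Fin n) n 1 1 where
  entryA := companion n Sum.inl
  entryB := Matrix.of fun i _ => .pos (Sum.inr i)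
  entryC := Matrix.of fun _ j => if (j : ℕ) = 0 then .fixed 1 else .fixed 0

noncomputable section

/-- The partial derivative `∂f/∂θ_i` at `θ`. -/
def pderiv {ι : Type*} [Fintype ι] [DecidableEq ι] (i : ι) (f : (ι → ℝ) → ℝ) (θ : ι → ℝ) : ℝ :=
  fderiv ℝ f θ (Pi.single i 1)

/-- The Jacobian matrix `∂f/∂θ` at `θ`; rows are components of `f`, columns are parameters. -/
def jacobian {ι κ : Type*} [Fintype ι] [DecidableEq ι] (f : (ι → ℝ) → κ → ℝ) (θ : ι → ℝ) :
    Matrix κ ι ℝ :=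
  Matrix.of fun k i => pderiv i (fun θ' => f θ' k) θ

/-- The entrywise partial derivative `∂M/∂θ_i` of a matrix function. -/
def matDeriv {ι m n : Type*} [Fintype ι] [DecidableEq ι] (i : ι)
    (M : (ι → ℝ) → Matrix m n ℝ) (θ : ι → ℝ) : Matrix m n ℝ :=
  Matrix.of fun r c => pderiv i (fun θ' => M θ' r c) θ

/-- The density of the `d`-dimensional Gaussian law with mean `m` and covariance `S`. -/
def gaussianDensity {d : ℕ} (m : Fin d → ℝ) (S : Matrix (Fin d) (Fin d) ℝ) (v : Fin d → ℝ) : ℝ :=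
  (√((2 * Real.pi) ^ d * S.det))⁻¹ * Real.exp (-(1 / 2) * ((v - m) ⬝ᵥ (S⁻¹ *ᵥ (v - m))))

/-- The random vector `X` has the Gaussian law with mean `m` and covariance `S`. -/
def IsGaussianVector {Ω : Type*} [MeasurableSpace Ω] {d : ℕ} (X : Ω → Fin d → ℝ)
    (m : Fin d → ℝ) (S : Matrix (Fin d) (Fin d) ℝ) (P : Measure Ω) : Prop :=
  HasLaw (fun ω => WithLp.toLp 2 (X ω)) (multivariateGaussian (WithLp.toLp 2 m) S) P

section
variable {ι : Type*} {dx du dy : ℕ}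

namespace Form

/-- The state matrix `A(θ)`. -/
def A (F : Form ι dx du dy) (θ : ι → ℝ) : Matrix (Fin dx) (Fin dx) ℝ := F.entryA.map (Entry.eval θ)

/-- The input matrix `B(θ)`. -/
def B (F : Form ι dx du dy) (θ : ι → ℝ) : Matrix (Fin dx) (Fin du) ℝ := F.entryB.map (Entry.eval θ)

/-- The observation matrix `C(θ)`. -/
def C (F : Form ι dx du dy) (θ : ι → ℝ) : Matrix (Fin dy) (Fin dx) ℝ := F.entryC.map (Entry.eval θ)

end Form

/-- A system `x_{t+1} = A x_t + B u_t + w_t`, `y_t = C x_t + z_t` whose matrices have a given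
canonical structure, together with the known inputs `u_0, u_1, …`, the mean and covariance of the
initial state and the covariances of the process and the measurement noise. -/
structure Model (ι : Type*) (dx du dy : ℕ) extends Form ι dx du dy where
  input : ℕ → Fin du → ℝ
  initMean : Fin dx → ℝ
  initCov : Matrix (Fin dx) (Fin dx) ℝ
  procCov : Matrix (Fin dx) (Fin dx) ℝ
  measCov : Matrix (Fin dy) (Fin dy) ℝ

/-- `x0`, `w` and `z` are the initial state, the process noise and the measurement noise of the
model: Gaussian with the prescribed moments, and all mutually independent. -/
structure IsNoise {Ω : Type*} [MeasurableSpace Ω] (M : Model ι dx du dy) (P : Measure Ω)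
    (x0 : Ω → Fin dx → ℝ) (w : ℕ → Ω → Fin dx → ℝ) (z : ℕ → Ω → Fin dy → ℝ) : Prop where
  law_init : IsGaussianVector x0 M.initMean M.initCov P
  law_proc : ∀ t, IsGaussianVector (w t) 0 M.procCov P
  law_meas : ∀ t, IsGaussianVector (z t) 0 M.measCov P
  indep_proc : iIndepFun w P
  indep_meas : iIndepFun z P
  indep_proc_meas : IndepFun (fun ω t => w t ω) (fun ω t => z t ω) P
  indep_init : IndepFun x0 (fun ω => ((fun t => w t ω), (fun t => z t ω))) P

namespace Model

/-- The state `x_t` of the system with parameter `θ`. -/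
def state {Ω : Type*} (M : Model ι dx du dy) (x0 : Ω → Fin dx → ℝ) (w : ℕ → Ω → Fin dx → ℝ)
    (θ : ι → ℝ) (ω : Ω) : ℕ → Fin dx → ℝ
  | 0 => x0 ω
  | t + 1 => M.A θ *ᵥ M.state x0 w θ ω t + M.B θ *ᵥ M.input t + w t ω

/-- The outputs `y_1, …, y_T` of the system with parameter `θ`; component `t` is `y_{t+1}`. -/
def output {Ω : Type*} (M : Model ι dx du dy) (T : ℕ) (x0 : Ω → Fin dx → ℝ)
    (w : ℕ → Ω → Fin dx → ℝ) (z : ℕ → Ω → Fin dy → ℝ) (θ : ι → ℝ) (ω : Ω) :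
    Fin T → Fin dy → ℝ :=
  fun t => M.C θ *ᵥ M.state x0 w θ ω (t + 1) + z (t + 1) ω

/-- The distribution of the outputs `y_1, …, y_T` under the parameter `θ`. -/
def outputLaw {Ω : Type*} [MeasurableSpace Ω] (M : Model ι dx du dy) (T : ℕ) (P : Measure Ω)
    (x0 : Ω → Fin dx → ℝ) (w : ℕ → Ω → Fin dx → ℝ) (z : ℕ → Ω → Fin dy → ℝ) (θ : ι → ℝ) :
    Measure (Fin T → Fin dy → ℝ) :=
  P.map (M.output T x0 w z θ)

/-- The likelihood `p(y_1, …, y_T | θ)`: the latent states are marginalized out of the conditional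
density of the observations given the states. -/
def likelihood {Ω : Type*} [MeasurableSpace Ω] (M : Model ι dx du dy) (T : ℕ) (P : Measure Ω)
    (x0 : Ω → Fin dx → ℝ) (w : ℕ → Ω → Fin dx → ℝ) (θ : ι → ℝ) (y : Fin T → Fin dy → ℝ) : ℝ :=
  ∫ ω, ∏ t : Fin T, gaussianDensity (M.C θ *ᵥ M.state x0 w θ ω (t + 1)) M.measCov (y t) ∂P

/-- The log-likelihood. -/
def logLikelihood {Ω : Type*} [MeasurableSpace Ω] (M : Model ι dx du dy) (T : ℕ) (P : Measure Ω)
    (x0 : Ω → Fin dx → ℝ) (w : ℕ → Ω → Fin dx → ℝ) (θ : ι → ℝ) (y : Fin T → Fin dy → ℝ) : ℝ :=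
  Real.log (M.likelihood T P x0 w θ y)

/-- The Fisher information matrix: the expectation, under the law of the outputs with parameter
`θ`, of the outer product of the score with itself. -/
def fisherInformation {Ω : Type*} [MeasurableSpace Ω] [Fintype ι] [DecidableEq ι]
    (M : Model ι dx du dy) (T : ℕ) (P : Measure Ω)
    (x0 : Ω → Fin dx → ℝ) (w : ℕ → Ω → Fin dx → ℝ) (z : ℕ → Ω → Fin dy → ℝ) (θ : ι → ℝ) :
    Matrix ι ι ℝ :=
  Matrix.of fun i j => ∫ y, pderiv i (fun θ' => M.logLikelihood T P x0 w θ' y) θ *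
    pderiv j (fun θ' => M.logLikelihood T P x0 w θ' y) θ ∂(M.outputLaw T P x0 w z θ)

/-! The Kalman filter. Time is shifted by one in the prediction, innovation and gain: the value at
`t` belongs to the observation time `t + 1`. -/

/-- One prediction step for the covariance: `A P Aᵀ + Σ`. -/
def predictCov (M : Model ι dx du dy) (θ : ι → ℝ) (P : Matrix (Fin dx) (Fin dx) ℝ) :
    Matrix (Fin dx) (Fin dx) ℝ :=
  M.A θ * P * (M.A θ)ᵀ + M.procCov

/-- The innovation covariance `C P Cᵀ + Γ` of a predicted covariance `P`. -/
def residualCov (M : Model ι dx du dy) (θ : ι → ℝ) (P : Matrix (Fin dx) (Fin dx) ℝ) :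
    Matrix (Fin dy) (Fin dy) ℝ :=
  M.C θ * P * (M.C θ)ᵀ + M.measCov

/-- The Kalman gain `P Cᵀ (C P Cᵀ + Γ)⁻¹` of a predicted covariance `P`. -/
def gainOf (M : Model ι dx du dy) (θ : ι → ℝ) (P : Matrix (Fin dx) (Fin dx) ℝ) :
    Matrix (Fin dx) (Fin dy) ℝ :=
  P * (M.C θ)ᵀ * (M.residualCov θ P)⁻¹

/-- The filter covariance `P_{t|t}`, with `P_{0|0}` the covariance of the initial state. -/
def filtCov (M : Model ι dx du dy) (θ : ι → ℝ) : ℕ → Matrix (Fin dx) (Fin dx) ℝ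
  | 0 => M.initCov
  | t + 1 =>
    let P := M.predictCov θ (M.filtCov θ t)
    P - M.gainOf θ P * M.C θ * P

/-- The predicted covariance `P_{t+1|t}`. -/
def predCov (M : Model ι dx du dy) (θ : ι → ℝ) (t : ℕ) : Matrix (Fin dx) (Fin dx) ℝ :=
  M.predictCov θ (M.filtCov θ t)

/-- The innovation covariance `S_{t+1} = C P_{t+1|t} Cᵀ + Γ`. -/
def innovCov (M : Model ι dx du dy) (θ : ι → ℝ) (t : ℕ) : Matrix (Fin dy) (Fin dy) ℝ :=
  M.residualCov θ (M.predCov θ t)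

/-- The Kalman gain `K_{t+1} = P_{t+1|t} Cᵀ S_{t+1}⁻¹`. -/
def gain (M : Model ι dx du dy) (θ : ι → ℝ) (t : ℕ) : Matrix (Fin dx) (Fin dy) ℝ :=
  M.gainOf θ (M.predCov θ t)

/-- The observation `y_{t+1}` of a finite record (zero after its end, where it is never used). -/
def obs {T : ℕ} (y : Fin T → Fin dy → ℝ) (t : ℕ) : Fin dy → ℝ :=
  if h : t < T then y ⟨t, h⟩ else 0

/-- The filter mean `x̂_{t|t}`, with `x̂_{0|0}` the mean of the initial state. -/
def filtMean {T : ℕ} (M : Model ι dx du dy) (θ : ι → ℝ) (y : Fin T → Fin dy → ℝ) :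
    ℕ → Fin dx → ℝ
  | 0 => M.initMean
  | t + 1 =>
    let x := M.A θ *ᵥ M.filtMean θ y t + M.B θ *ᵥ M.input t
    x + M.gain θ t *ᵥ (obs y t - M.C θ *ᵥ x)

/-- The predicted mean `x̂_{t+1|t} = A x̂_{t|t} + B u_t`. -/
def predMean {T : ℕ} (M : Model ι dx du dy) (θ : ι → ℝ) (y : Fin T → Fin dy → ℝ) (t : ℕ) :
    Fin dx → ℝ :=
  M.A θ *ᵥ M.filtMean θ y t + M.B θ *ᵥ M.input t

/-- The innovation `ν_{t+1} = y_{t+1} - C x̂_{t+1|t}`. -/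
def innov {T : ℕ} (M : Model ι dx du dy) (θ : ι → ℝ) (y : Fin T → Fin dy → ℝ) (t : ℕ) :
    Fin dy → ℝ :=
  obs y t - M.C θ *ᵥ M.predMean θ y t

/-! The sensitivity recursions: the derivatives of the system matrices are propagated through the
filter with the rules of differentiation. The initial moments, the noise covariances and the
inputs do not depend on the parameters. -/

variable [Fintype ι] [DecidableEq ι]

/-- Sensitivity of the prediction step, for a filter covariance `P` with sensitivity `dP`. -/
def dPredictCov (M : Model ι dx du dy) (θ : ι → ℝ) (i : ι) (P dP : Matrix (Fin dx) (Fin dx) ℝ) :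
    Matrix (Fin dx) (Fin dx) ℝ :=
  matDeriv i M.A θ * P * (M.A θ)ᵀ + M.A θ * dP * (M.A θ)ᵀ + M.A θ * P * (matDeriv i M.A θ)ᵀ

/-- Sensitivity of the innovation covariance, for a predicted covariance `P` with
sensitivity `dP`. -/
def dResidualCov (M : Model ι dx du dy) (θ : ι → ℝ) (i : ι)
    (P dP : Matrix (Fin dx) (Fin dx) ℝ) : Matrix (Fin dy) (Fin dy) ℝ :=
  matDeriv i M.C θ * P * (M.C θ)ᵀ + M.C θ * dP * (M.C θ)ᵀ + M.C θ * P * (matDeriv i M.C θ)ᵀ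

/-- Sensitivity of the Kalman gain, for a predicted covariance `P` with sensitivity `dP`. -/
def dGainOf (M : Model ι dx du dy) (θ : ι → ℝ) (i : ι) (P dP : Matrix (Fin dx) (Fin dx) ℝ) :
    Matrix (Fin dx) (Fin dy) ℝ :=
  dP * (M.C θ)ᵀ * (M.residualCov θ P)⁻¹ + P * (matDeriv i M.C θ)ᵀ * (M.residualCov θ P)⁻¹
    - P * (M.C θ)ᵀ * ((M.residualCov θ P)⁻¹ * M.dResidualCov θ i P dP * (M.residualCov θ P)⁻¹)

/-- Sensitivity of `P_{t|t}`. -/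
def dFiltCov (M : Model ι dx du dy) (θ : ι → ℝ) (i : ι) : ℕ → Matrix (Fin dx) (Fin dx) ℝ
  | 0 => 0
  | t + 1 =>
    let P := M.predCov θ t
    let dP := M.dPredictCov θ i (M.filtCov θ t) (M.dFiltCov θ i t)
    dP - (M.dGainOf θ i P dP * M.C θ * P + M.gain θ t * matDeriv i M.C θ * P
      + M.gain θ t * M.C θ * dP)

/-- Sensitivity of `P_{t+1|t}`. -/
def dPredCov (M : Model ι dx du dy) (θ : ι → ℝ) (i : ι) (t : ℕ) : Matrix (Fin dx) (Fin dx) ℝ :=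
  M.dPredictCov θ i (M.filtCov θ t) (M.dFiltCov θ i t)

/-- Sensitivity of `S_{t+1}`. -/
def dInnovCov (M : Model ι dx du dy) (θ : ι → ℝ) (i : ι) (t : ℕ) : Matrix (Fin dy) (Fin dy) ℝ :=
  M.dResidualCov θ i (M.predCov θ t) (M.dPredCov θ i t)

/-- Sensitivity of `K_{t+1}`. -/
def dGain (M : Model ι dx du dy) (θ : ι → ℝ) (i : ι) (t : ℕ) : Matrix (Fin dx) (Fin dy) ℝ :=
  M.dGainOf θ i (M.predCov θ t) (M.dPredCov θ i t)

/-- Sensitivity of `x̂_{t|t}`. -/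
def dFiltMean {T : ℕ} (M : Model ι dx du dy) (θ : ι → ℝ) (y : Fin T → Fin dy → ℝ) (i : ι) :
    ℕ → Fin dx → ℝ
  | 0 => 0
  | t + 1 =>
    let dx' := matDeriv i M.A θ *ᵥ M.filtMean θ y t + M.A θ *ᵥ M.dFiltMean θ y i t
      + matDeriv i M.B θ *ᵥ M.input t
    dx' + M.dGain θ i t *ᵥ M.innov θ y t
      + M.gain θ t *ᵥ (-(M.C θ *ᵥ dx') - matDeriv i M.C θ *ᵥ M.predMean θ y t)

/-- Sensitivity of `x̂_{t+1|t}`. -/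
def dPredMean {T : ℕ} (M : Model ι dx du dy) (θ : ι → ℝ) (y : Fin T → Fin dy → ℝ) (i : ι)
    (t : ℕ) : Fin dx → ℝ :=
  matDeriv i M.A θ *ᵥ M.filtMean θ y t + M.A θ *ᵥ M.dFiltMean θ y i t
    + matDeriv i M.B θ *ᵥ M.input t

/-- Sensitivity of `ν_{t+1}`. -/
def dInnov {T : ℕ} (M : Model ι dx du dy) (θ : ι → ℝ) (y : Fin T → Fin dy → ℝ) (i : ι)
    (t : ℕ) : Fin dy → ℝ :=
  -(M.C θ *ᵥ M.dPredMean θ y i t) - matDeriv i M.C θ *ᵥ M.predMean θ y t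

/-- The matrix `(∂ν/∂θ)ᵀ S⁻¹ (∂ν/∂θ) + ½ (∂vec S/∂θ)ᵀ (S⁻¹ ⊗ S⁻¹) (∂vec S/∂θ)` at time `t + 1`,
for the data `y`. -/
def infoTerm {T : ℕ} (M : Model ι dx du dy) (θ : ι → ℝ) (y : Fin T → Fin dy → ℝ) (t : ℕ) :
    Matrix ι ι ℝ :=
  (jacobian (fun θ' => M.innov θ' y t) θ)ᵀ * (M.innovCov θ t)⁻¹ *
      jacobian (fun θ' => M.innov θ' y t) θ
    + (1 / 2 : ℝ) • ((jacobian (fun θ' => (M.innovCov θ' t).vec) θ)ᵀ *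
      ((M.innovCov θ t)⁻¹ ⊗ₖ (M.innovCov θ t)⁻¹) *
      jacobian (fun θ' => (M.innovCov θ' t).vec) θ)

end Model

end

end

end LTI

/-! The likelihood is computed exactly by the unnormalized filter. For any test function `g`, the
expectation of `g(x_t)` times the observation densities up to time `t` equals the product of the
innovation densities `N(y_s; C x̂_{s|s-1}, S_s)` times the integral of `g` against `N(x̂_{t|t},
P_{t|t})` (`lintegral_state_mul_prod`). The induction step is a prediction (affine image of a
Gaussian plus independent noise) followed by a Bayes update
(`lintegral_mul_gaussianDensity_gaussVec`), which is completion of the square. Taking `g = 1` gives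
the prediction error decomposition. That the likelihood is the density of the outputs is Tonelli,
because the outputs are the path `C x_t` plus an independent noise that has a density.

Initial and process covariances may be singular, so Gaussian laws are handled through characteristic
functions, and a semidefinite covariance is written as `L Lᵀ` to reduce to standard Gaussian
coordinates.

The log-likelihood is then an explicit function of filter quantities. Differentiability and the
sensitivity recursions follow from the product rule and the derivatives of the determinant and the
inverse; no derivative is ever taken under an integral sign.

For the Fisher information, the law of `T + 1` outputs is the law of `T` outputs times a Gaussian `v
~ N(0, S)`, transported by `(y, v) ↦ (y, C x̂(y) + v)` (`outputLaw_succ`). The new score increment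
is a centred quadratic form in `v` plus a linear form whose coefficient `∂ν` depends only on the
past. With the past frozen it has mean zero, so the increments are orthogonal, and its second moment
comes from the fourth Gaussian moments (`integral_scoreTerm_mul_scoreTerm`). Summing over time gives
the formula (`memLp_and_integral_score`). -/

namespace LTI

/-! ### Densities of finite product measures. -/

section TonelliPi

theorem lintegral_fin_prod_eq_prod {n : ℕ} {E : Fin n → Type*} [∀ i, MeasurableSpace (E i)]
    (μ : ∀ i, Measure (E i)) [∀ i, SigmaFinite (μ i)] (f : ∀ i, E i → ENNReal)
    (hf : ∀ i, Measurable (f i)) :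
    ∫⁻ x, ∏ i, f i (x i) ∂Measure.pi μ = ∏ i, ∫⁻ x, f i x ∂μ i := by
  induction n with
  | zero => simp
  | succ n ih =>
    have h := (measurePreserving_piFinSuccAbove μ 0).symm
    have hm : ∀ i, Measurable (fun y : (∀ j : Fin n, E (Fin.succ j)) => f i.succ (y i)) :=
      fun i => (hf _).comp (measurable_pi_apply i)
    have hm' : Measurable (fun x : ∀ i, E i => ∏ i, f i (x i)) :=
      Finset.measurable_prod _ fun i _ => (hf i).comp (measurable_pi_apply i)
    rw [← h.lintegral_comp hm', Fin.prod_univ_succ, ← ih (fun i => μ i.succ) _ fun i => hf _]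
    simp_rw [MeasurableEquiv.piFinSuccAbove_symm_apply, Fin.insertNthEquiv, Fin.prod_univ_succ,
      Fin.insertNth_zero, Equiv.coe_fn_mk, Fin.cons_succ, Fin.zero_succAbove, Fin.cons_zero]
    have : SigmaFinite (Measure.pi fun j : Fin n => μ j.succ) :=
      Measure.pi.sigmaFinite fun j : Fin n => μ j.succ
    exact lintegral_prod_mul (μ := μ 0) (ν := Measure.pi fun j : Fin n => μ j.succ)
      (f := f 0) (g := fun y => ∏ i, f (Fin.succ i) (y i)) (hf 0).aemeasurable
      (Finset.measurable_prod _ fun i _ => hm i).aemeasurable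

/-- Both sides agree on boxes by Tonelli. Sigma-finiteness of the factors is a hypothesis because `f
i` is an arbitrary measurable function, possibly infinite. -/
theorem pi_withDensity {n : ℕ} {E : Fin n → Type*} [∀ i, MeasurableSpace (E i)]
    (μ : ∀ i, Measure (E i)) [∀ i, SigmaFinite (μ i)] (f : ∀ i, E i → ENNReal)
    (hf : ∀ i, Measurable (f i)) (hσ : ∀ i, SigmaFinite ((μ i).withDensity (f i))) :
    Measure.pi (fun i => (μ i).withDensity (f i))
      = (Measure.pi μ).withDensity (fun x => ∏ i, f i (x i)) := by
  refine (Measure.pi_eq fun s hs => ?_)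
  rw [withDensity_apply _ (MeasurableSet.univ_pi hs), Measure.restrict_pi_pi,
    lintegral_fin_prod_eq_prod _ _ hf]
  exact Finset.prod_congr rfl fun i _ => (withDensity_apply _ (hs i)).symm

end TonelliPi

/-! ### Gaussian laws through characteristic functions. -/

noncomputable section

variable {d e : ℕ}

/-- The Gaussian law with mean `m` and covariance `S` as a measure on `Fin d → ℝ`. -/
def gaussVec (m : Fin d → ℝ) (S : Matrix (Fin d) (Fin d) ℝ) : Measure (Fin d → ℝ) :=
  (multivariateGaussian (WithLp.toLp 2 m) S).map (WithLp.ofLp)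

instance (m : Fin d → ℝ) (S : Matrix (Fin d) (Fin d) ℝ) : IsProbabilityMeasure (gaussVec m S) :=
  Measure.isProbabilityMeasure_map (by fun_prop)

instance (m : Fin d → ℝ) (S : Matrix (Fin d) (Fin d) ℝ) : IsGaussian (gaussVec m S) := by
  have := isGaussian_map_equiv (μ := multivariateGaussian (WithLp.toLp 2 m) S)
    (EuclideanSpace.equiv (Fin d) ℝ)
  exact this

theorem integral_cexp_gaussVec (m : Fin d → ℝ) {S : Matrix (Fin d) (Fin d) ℝ} (hS : S.PosSemidef)
    (a : Fin d → ℝ) :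
    ∫ x, Complex.exp ((a ⬝ᵥ x : ℝ) * Complex.I) ∂gaussVec m S
      = Complex.exp ((a ⬝ᵥ m : ℝ) * Complex.I - (a ⬝ᵥ (S *ᵥ a) : ℝ) / 2) := by
  have h := charFun_multivariateGaussian (μ := WithLp.toLp 2 m) hS (WithLp.toLp 2 a)
  rw [charFun_apply] at h
  rw [gaussVec, integral_map (by fun_prop) (by
    refine Measurable.aestronglyMeasurable ?_
    unfold dotProduct
    fun_prop)]
  simpa [EuclideanSpace.inner_eq_star_dotProduct, dotProduct_comm] using h

/-- Every continuous linear functional on `Fin d → ℝ` is a dot product with the vector of its values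
on the standard basis, so these integrals are the whole characteristic function. -/
theorem ext_of_cexp_dotProduct {μ ν : Measure (Fin d → ℝ)} [IsFiniteMeasure μ] [IsFiniteMeasure ν]
    (h : ∀ a : Fin d → ℝ, ∫ x, Complex.exp ((a ⬝ᵥ x : ℝ) * Complex.I) ∂μ
      = ∫ x, Complex.exp ((a ⬝ᵥ x : ℝ) * Complex.I) ∂ν) : μ = ν := by
  refine Measure.ext_of_charFunDual (funext fun L => ?_)
  have hL : ∀ x, L x = (fun i => L (Pi.single i 1)) ⬝ᵥ x := by
    intro x
    conv_lhs => rw [pi_eq_sum_univ' x]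
    simp [dotProduct, mul_comm]
  rw [charFunDual_apply, charFunDual_apply]
  have h2 : ∀ x, Complex.exp (L x * Complex.I)
      = Complex.exp (((fun i => L (Pi.single i 1)) ⬝ᵥ x : ℝ) * Complex.I) := fun x => by rw [← hL]
  simp_rw [h2]
  exact h _

theorem eq_gaussVec {μ : Measure (Fin d → ℝ)} [IsFiniteMeasure μ] {m : Fin d → ℝ}
    {S : Matrix (Fin d) (Fin d) ℝ} (hS : S.PosSemidef)
    (h : ∀ a : Fin d → ℝ, ∫ x, Complex.exp ((a ⬝ᵥ x : ℝ) * Complex.I) ∂μ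
      = Complex.exp ((a ⬝ᵥ m : ℝ) * Complex.I - (a ⬝ᵥ (S *ᵥ a) : ℝ) / 2)) :
    μ = gaussVec m S :=
  ext_of_cexp_dotProduct fun a => by rw [h, integral_cexp_gaussVec m hS]

theorem measurable_dotProduct_left (a : Fin d → ℝ) : Measurable (fun x : Fin d → ℝ => a ⬝ᵥ x) := by
  unfold dotProduct
  fun_prop

@[fun_prop]
theorem measurable_mulVec (A : Matrix (Fin e) (Fin d) ℝ) :
    Measurable (fun x : Fin d → ℝ => A *ᵥ x) :=
  measurable_pi_lambda _ fun _ => measurable_dotProduct_left _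

theorem posSemidef_mul_mul_transpose {P : Matrix (Fin d) (Fin d) ℝ} (hP : P.PosSemidef)
    (A : Matrix (Fin e) (Fin d) ℝ) : (A * P * Aᵀ).PosSemidef := by
  simpa using hP.mul_mul_conjTranspose_same A

/-- The characteristic function of the image at `a` is a phase times that of the source at `Aᵀ a`.
Densities would not do here: `A` may be rectangular or singular, and so may `S`. -/
theorem map_affine_gaussVec (m : Fin d → ℝ) {S : Matrix (Fin d) (Fin d) ℝ} (hS : S.PosSemidef)
    (b : Fin e → ℝ) (A : Matrix (Fin e) (Fin d) ℝ) :
    (gaussVec m S).map (fun x => b + A *ᵥ x) = gaussVec (b + A *ᵥ m) (A * S * Aᵀ) := by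
  have hm : Measurable (fun x : Fin d → ℝ => b + A *ᵥ x) := by fun_prop
  have := Measure.isProbabilityMeasure_map (μ := gaussVec m S) hm.aemeasurable
  refine eq_gaussVec (posSemidef_mul_mul_transpose hS A) fun a => ?_
  rw [integral_map hm.aemeasurable (by
    refine Measurable.aestronglyMeasurable ?_
    have := measurable_dotProduct_left a
    fun_prop)]
  have h1 : ∀ x : Fin d → ℝ, a ⬝ᵥ (A *ᵥ x) = (Aᵀ *ᵥ a) ⬝ᵥ x := fun x => by
    rw [dotProduct_mulVec, mulVec_transpose]
  simp_rw [dotProduct_add, h1, Complex.ofReal_add, add_mul, Complex.exp_add]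
  rw [integral_const_mul, integral_cexp_gaussVec m hS, ← Complex.exp_add]
  rw [← mulVec_mulVec, ← mulVec_mulVec, h1, add_sub_assoc]

theorem map_add_gaussVec (m m' : Fin d → ℝ) {S S' : Matrix (Fin d) (Fin d) ℝ}
    (hS : S.PosSemidef) (hS' : S'.PosSemidef) :
    ((gaussVec m S).prod (gaussVec m' S')).map (fun p => p.1 + p.2)
      = gaussVec (m + m') (S + S') := by
  have hm : Measurable (fun p : (Fin d → ℝ) × (Fin d → ℝ) => p.1 + p.2) := by fun_prop
  have := Measure.isProbabilityMeasure_map (μ := (gaussVec m S).prod (gaussVec m' S'))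
    hm.aemeasurable
  refine eq_gaussVec (hS.add hS') fun a => ?_
  rw [integral_map hm.aemeasurable (by
    refine Measurable.aestronglyMeasurable ?_
    have := measurable_dotProduct_left a
    fun_prop)]
  simp_rw [dotProduct_add, Complex.ofReal_add, add_mul, Complex.exp_add]
  rw [integral_prod_mul (fun x => Complex.exp ((a ⬝ᵥ x : ℝ) * Complex.I))
    (fun x => Complex.exp ((a ⬝ᵥ x : ℝ) * Complex.I)), integral_cexp_gaussVec m hS,
    integral_cexp_gaussVec m' hS', ← Complex.exp_add]
  congr 1
  rw [add_mulVec, dotProduct_add]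
  push_cast
  ring

theorem gaussVec_zero_one :
    gaussVec (0 : Fin d → ℝ) 1 = Measure.pi (fun _ : Fin d => gaussianReal 0 1) := by
  rw [gaussVec, WithLp.toLp_zero, multivariateGaussian_zero_one, ← map_pi_eq_stdGaussian,
    Measure.map_map (by fun_prop) (by fun_prop)]
  exact Measure.map_id

theorem isGaussianVector_iff_map {Ω : Type*} [MeasurableSpace Ω] {X : Ω → Fin d → ℝ}
    {m : Fin d → ℝ} {S : Matrix (Fin d) (Fin d) ℝ} {P : Measure Ω}
    (h : IsGaussianVector X m S P) : AEMeasurable X P ∧ P.map X = gaussVec m S := by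
  have h1 : AEMeasurable X P := by
    have := (PiLp.continuous_ofLp 2 (fun _ : Fin d => ℝ)).measurable.comp_aemeasurable
      h.aemeasurable
    exact this
  refine ⟨h1, ?_⟩
  rw [gaussVec, ← h.map_eq, AEMeasurable.map_map_of_aemeasurable (by fun_prop) h.aemeasurable]
  rfl

end


/-! ### Gaussian densities and conditioning on a linear observation. -/

noncomputable section

variable {d e : ℕ}

/-- Makes every semidefinite covariance reachable from the standard Gaussian by `ξ ↦ m + L ξ`; `L`
is the symmetric square root. -/
theorem exists_eq_mul_transpose {S : Matrix (Fin d) (Fin d) ℝ} (hS : S.PosSemidef) :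
    ∃ L : Matrix (Fin d) (Fin d) ℝ, S = L * Lᵀ := by
  open scoped MatrixOrder in
  refine ⟨CFC.sqrt S, ?_⟩
  have h : (CFC.sqrt S).IsHermitian := (CFC.sqrt_nonneg S).isSelfAdjoint
  have h2 : (CFC.sqrt S)ᵀ = CFC.sqrt S := by simpa [Matrix.IsHermitian] using h
  rw [h2, CFC.sqrt_mul_sqrt_self _ hS.nonneg]

theorem posDef_transpose {S : Matrix (Fin d) (Fin d) ℝ} (hS : S.PosDef) : Sᵀ = S := by
  simpa [Matrix.IsHermitian] using hS.isHermitian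

theorem posDef_isUnit_det {S : Matrix (Fin d) (Fin d) ℝ} (hS : S.PosDef) : IsUnit S.det :=
  hS.det_pos.ne'.isUnit

theorem measurable_dotProduct_mulVec (A : Matrix (Fin d) (Fin d) ℝ) :
    Measurable (fun x : Fin d → ℝ => x ⬝ᵥ (A *ᵥ x)) := by
  unfold dotProduct mulVec dotProduct
  fun_prop

@[fun_prop]
theorem measurable_gaussianDensity_comp {α : Type*} [MeasurableSpace α] {f g : α → Fin d → ℝ}
    (hf : Measurable f) (hg : Measurable g) (S : Matrix (Fin d) (Fin d) ℝ) :
    Measurable (fun x => gaussianDensity (f x) S (g x)) := by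
  unfold gaussianDensity
  have := (measurable_dotProduct_mulVec S⁻¹).comp (hg.sub hf)
  simp only [Function.comp_def, Pi.sub_apply] at this
  fun_prop

theorem measurable_gaussianDensity (m : Fin d → ℝ) (S : Matrix (Fin d) (Fin d) ℝ) :
    Measurable (gaussianDensity m S) :=
  measurable_gaussianDensity_comp measurable_const measurable_id S

theorem gaussianDensity_pos (m : Fin d → ℝ) {S : Matrix (Fin d) (Fin d) ℝ} (hS : S.PosDef)
    (v : Fin d → ℝ) : 0 < gaussianDensity m S v := by
  have := hS.det_pos
  unfold gaussianDensity
  positivity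

theorem lintegral_comp_affine (m : Fin d → ℝ) {L : Matrix (Fin d) (Fin d) ℝ} (hL : L.det ≠ 0)
    {f : (Fin d → ℝ) → ENNReal} (hf : Measurable f) :
    ∫⁻ x, f (m + L *ᵥ x) = ENNReal.ofReal |L.det⁻¹| * ∫⁻ x, f x := by
  have h := Real.map_matrix_volume_pi_eq_smul_volume_pi hL
  have h2 : ∫⁻ x, f (m + L *ᵥ x) = ∫⁻ x, f (m + x) ∂(Measure.map (toLin' L) volume) := by
    rw [lintegral_map (by fun_prop) (by
      have := measurable_mulVec L
      exact this)]
    simp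
  rw [h2, h, lintegral_smul_measure, smul_eq_mul, lintegral_add_left_eq_self]

theorem gaussVec_zero_one_eq_withDensity :
    gaussVec (0 : Fin d → ℝ) 1
      = volume.withDensity (fun v => ENNReal.ofReal (gaussianDensity 0 1 v)) := by
  rw [gaussVec_zero_one, gaussianReal_of_var_ne_zero _ one_ne_zero]
  have : ∀ i : Fin d, SigmaFinite ((volume : Measure ℝ).withDensity (gaussianPDF 0 1)) := by
    intro i
    rw [← gaussianReal_of_var_ne_zero _ one_ne_zero]
    infer_instance
  rw [pi_withDensity (fun _ : Fin d => (volume : Measure ℝ)) (fun _ => gaussianPDF 0 1)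
    (fun _ => measurable_gaussianPDF 0 1) this]
  rw [← volume_pi]
  congr 1
  funext x
  simp_rw [gaussianPDF]
  rw [← ENNReal.ofReal_prod_of_nonneg fun i _ => gaussianPDFReal_nonneg _ _ _]
  congr 1
  simp only [gaussianPDFReal, gaussianDensity, Finset.prod_mul_distrib, ← Real.exp_sum]
  congr 1
  · rw [Finset.prod_const, Finset.card_univ, Fintype.card_fin, det_one, mul_one, NNReal.coe_one,
      mul_one, inv_pow, eq_comm]
    congr 1
    rw [Real.sqrt_eq_iff_mul_self_eq (by positivity) (by positivity), ← mul_pow,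
      Real.mul_self_sqrt (by positivity)]
  · congr 1
    simp only [sub_zero, inv_one, one_mulVec, dotProduct, Finset.mul_sum, NNReal.coe_one]
    refine Finset.sum_congr rfl fun i _ => ?_
    ring

/-- With `S = L Lᵀ` and `L` invertible, the law is the image of the standard one under `ξ ↦ m + L
ξ`, and the Jacobian `|det L|` accounts for the change in the normalizing constant. -/
theorem gaussVec_eq_withDensity (m : Fin d → ℝ) {S : Matrix (Fin d) (Fin d) ℝ} (hS : S.PosDef) :
    gaussVec m S = volume.withDensity (fun v => ENNReal.ofReal (gaussianDensity m S v)) := by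
  obtain ⟨L, rfl⟩ := exists_eq_mul_transpose hS.posSemidef
  have hpos := hS.det_pos
  rw [det_mul, det_transpose] at hpos
  have hL : L.det ≠ 0 := fun h => by simp [h] at hpos
  have hLu : IsUnit L.det := hL.isUnit
  have h1 := map_affine_gaussVec (0 : Fin d → ℝ) (PosSemidef.one) m L
  rw [mulVec_zero, add_zero, mul_one] at h1
  have hψ : Measurable (fun x : Fin d → ℝ => m + L *ᵥ x) := by fun_prop
  -- The exponents agree because `Lᵀ (L Lᵀ)⁻¹ L = 1`; the factor `|det L|` is the ratio of the
  -- normalizations.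
  have hden : ∀ x, gaussianDensity 0 1 x
      = |L.det| * gaussianDensity m (L * Lᵀ) (m + L *ᵥ x) := by
    intro x
    have e1 : (L *ᵥ x) ⬝ᵥ ((L * Lᵀ)⁻¹ *ᵥ (L *ᵥ x)) = x ⬝ᵥ x := by
      rw [mulVec_mulVec, Matrix.mul_inv_rev, Matrix.mul_assoc, Matrix.nonsing_inv_mul _ hLu,
        Matrix.mul_one, dotProduct_mulVec, ← mulVec_transpose, mulVec_mulVec,
        transpose_nonsing_inv, transpose_transpose, Matrix.nonsing_inv_mul _ hLu, one_mulVec]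
    have hs : √((2 * Real.pi) ^ d * (L.det * L.det)) = √((2 * Real.pi) ^ d) * |L.det| := by
      rw [Real.sqrt_mul (by positivity), Real.sqrt_mul_self_eq_abs]
    have : |L.det| ≠ 0 := abs_ne_zero.mpr hL
    simp only [gaussianDensity, sub_zero, add_sub_cancel_left, e1, inv_one, one_mulVec, det_one,
      mul_one, det_mul, det_transpose, hs, mul_inv]
    field_simp
  have hdm : Measurable (fun v => ENNReal.ofReal (gaussianDensity m (L * Lᵀ) v)) :=
    (measurable_gaussianDensity _ _).ennreal_ofReal
  refine Measure.ext_of_lintegral _ fun f hf => ?_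
  rw [← h1, lintegral_map hf hψ, gaussVec_zero_one_eq_withDensity,
    lintegral_withDensity_eq_lintegral_mul _ (measurable_gaussianDensity _ _).ennreal_ofReal
      (show Measurable fun x => f (m + L *ᵥ x) from hf.comp hψ), lintegral_withDensity_eq_lintegral_mul _ hdm hf]
  simp_rw [Pi.mul_apply, hden, ENNReal.ofReal_mul (abs_nonneg _), mul_assoc]
  rw [lintegral_const_mul _ (by fun_prop), lintegral_comp_affine m hL
    (f := fun x => ENNReal.ofReal (gaussianDensity m (L * Lᵀ) x) * f x) (by fun_prop), ← mul_assoc,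
    ← ENNReal.ofReal_mul (abs_nonneg _), abs_inv, mul_inv_cancel₀ (abs_ne_zero.mpr hL)]
  simp

/-- Bayes' rule in whitened coordinates: the prior on `ξ` is standard, the observation is `c + H ξ`
plus noise of covariance `Γ`. The right side is evidence times posterior, with posterior precision
`1 + Hᵀ Γ⁻¹ H`. -/
theorem gaussianDensity_add_mul {y : Fin e → ℝ} (c : Fin e → ℝ)
    (H : Matrix (Fin e) (Fin d) ℝ) {Γ : Matrix (Fin e) (Fin e) ℝ} (hΓ : Γ.PosDef)
    (hS : (H * Hᵀ + Γ).PosDef) (hΛ : (1 + Hᵀ * Γ⁻¹ * H).PosDef) (ξ : Fin d → ℝ) :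
    gaussianDensity (c + H *ᵥ ξ) Γ y * gaussianDensity 0 1 ξ
      = gaussianDensity c (H * Hᵀ + Γ) y
        * gaussianDensity (Hᵀ *ᵥ ((H * Hᵀ + Γ)⁻¹ *ᵥ (y - c))) (1 + Hᵀ * Γ⁻¹ * H)⁻¹ ξ := by
  set S := H * Hᵀ + Γ with hSdef
  set Λ := 1 + Hᵀ * Γ⁻¹ * H with hΛdef
  set v := y - c with hv
  set s := S⁻¹ *ᵥ v with hs
  have hΓu := posDef_isUnit_det hΓ
  have hΓt : Γ⁻¹ᵀ = Γ⁻¹ := by rw [transpose_nonsing_inv, posDef_transpose hΓ]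
  -- This is `S s = v` rearranged; it eliminates `H Hᵀ` from every expression below.
  have hSs : H *ᵥ (Hᵀ *ᵥ s) = v - Γ *ᵥ s := by
    rw [eq_sub_iff_add_eq, mulVec_mulVec, ← add_mulVec, ← hSdef, hs, mulVec_mulVec,
      Matrix.mul_nonsing_inv _ (posDef_isUnit_det hS), one_mulVec]
  have hΓs : Γ⁻¹ *ᵥ (Γ *ᵥ s) = s := by
    rw [mulVec_mulVec, Matrix.nonsing_inv_mul _ hΓu, one_mulVec]
  have hmove : ∀ (a : Fin d → ℝ) (b : Fin e → ℝ), a ⬝ᵥ (Hᵀ *ᵥ b) = (H *ᵥ a) ⬝ᵥ b := by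
    intro a b
    rw [dotProduct_mulVec, vecMul_transpose]
  have hΓsymm : ∀ a b : Fin e → ℝ, a ⬝ᵥ (Γ⁻¹ *ᵥ b) = b ⬝ᵥ (Γ⁻¹ *ᵥ a) := by
    intro a b
    rw [dotProduct_mulVec, ← mulVec_transpose, hΓt, dotProduct_comm]
  have hΛv : ∀ a : Fin d → ℝ, Λ *ᵥ a = a + Hᵀ *ᵥ (Γ⁻¹ *ᵥ (H *ᵥ a)) := by
    intro a
    simp only [hΛdef, add_mulVec, one_mulVec, mulVec_mulVec, Matrix.mul_assoc]
  -- Completion of the square in `ξ` around the posterior mean `Hᵀ s`.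
  have hexp : (v - H *ᵥ ξ) ⬝ᵥ (Γ⁻¹ *ᵥ (v - H *ᵥ ξ)) + ξ ⬝ᵥ ξ
      = v ⬝ᵥ s + (ξ - Hᵀ *ᵥ s) ⬝ᵥ (Λ *ᵥ (ξ - Hᵀ *ᵥ s)) := by
    have e1 : v ⬝ᵥ (Γ⁻¹ *ᵥ (Γ *ᵥ s)) = v ⬝ᵥ s := by rw [hΓs]
    have e2 : (Γ *ᵥ s) ⬝ᵥ (Γ⁻¹ *ᵥ v) = v ⬝ᵥ s := by rw [hΓsymm, hΓs]
    have e3 : (Γ *ᵥ s) ⬝ᵥ (Γ⁻¹ *ᵥ (Γ *ᵥ s)) = (Γ *ᵥ s) ⬝ᵥ s := by rw [hΓs]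
    have e4 : (Hᵀ *ᵥ s) ⬝ᵥ (Hᵀ *ᵥ s) = v ⬝ᵥ s - (Γ *ᵥ s) ⬝ᵥ s := by
      rw [hmove, hSs, sub_dotProduct]
    have e5 : ξ ⬝ᵥ (Hᵀ *ᵥ s) = (H *ᵥ ξ) ⬝ᵥ s := hmove _ _
    have e6 : (Hᵀ *ᵥ s) ⬝ᵥ ξ = (H *ᵥ ξ) ⬝ᵥ s := by rw [dotProduct_comm, hmove]
    have e7 : (H *ᵥ ξ) ⬝ᵥ (Γ⁻¹ *ᵥ (Γ *ᵥ s)) = (H *ᵥ ξ) ⬝ᵥ s := by rw [hΓs]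
    have e8 : (Γ *ᵥ s) ⬝ᵥ (Γ⁻¹ *ᵥ (H *ᵥ ξ)) = (H *ᵥ ξ) ⬝ᵥ s := by rw [hΓsymm, hΓs]
    have e9 := hΓsymm v (H *ᵥ ξ)
    rw [hΛv, mulVec_sub H, hSs]
    simp only [mulVec_sub, sub_dotProduct, dotProduct_sub, dotProduct_add, hmove, hSs, hΓs] at *
    linarith
  -- `det (1 + Hᵀ (Γ⁻¹ H)) = det (1 + Γ⁻¹ H Hᵀ)`, hence `det Γ · det Λ = det S`; this matches the
  -- normalizing constants.
  have hdet : Γ.det * 1 = S.det * Λ⁻¹.det := by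
    have h1 : Γ.det * Λ.det = S.det := by
      rw [hΛdef, Matrix.mul_assoc, det_one_add_mul_comm, ← det_mul, Matrix.mul_add, Matrix.mul_one,
        Matrix.mul_assoc, Matrix.mul_nonsing_inv_cancel_left _ _ hΓu, add_comm]
    rw [← h1, mul_one, det_nonsing_inv, Ring.inverse_eq_inv', mul_assoc,
      mul_inv_cancel₀ hΛ.det_pos.ne', mul_one]
  have hpref : √((2 * Real.pi) ^ e * Γ.det) * √((2 * Real.pi) ^ d * (1 : Matrix (Fin d) (Fin d) ℝ).det)
      = √((2 * Real.pi) ^ e * S.det) * √((2 * Real.pi) ^ d * Λ⁻¹.det) := by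
    have h1 := hΓ.det_pos
    have h2 := hS.det_pos
    rw [← Real.sqrt_mul (by positivity), ← Real.sqrt_mul (by positivity), det_one,
      mul_mul_mul_comm, hdet, mul_mul_mul_comm]
  have hinv : Λ⁻¹⁻¹ = Λ := nonsing_inv_nonsing_inv _ (posDef_isUnit_det hΛ)
  have hy : y - (c + H *ᵥ ξ) = v - H *ᵥ ξ := by rw [hv, sub_add_eq_sub_sub]
  unfold gaussianDensity
  rw [mul_mul_mul_comm, ← mul_inv, hpref, ← Real.exp_add, mul_mul_mul_comm (√_)⁻¹, ← mul_inv,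
    ← Real.exp_add, hinv, hy, sub_zero, inv_one, one_mulVec, ← mul_add, hexp, ← mul_add]

theorem posDef_one_add_transpose_mul_mul (H : Matrix (Fin e) (Fin d) ℝ)
    {Γ : Matrix (Fin e) (Fin e) ℝ} (hΓ : Γ.PosDef) : (1 + Hᵀ * Γ⁻¹ * H).PosDef := by
  refine PosDef.one.add_posSemidef ?_
  simpa using hΓ.inv.posSemidef.conjTranspose_mul_mul_same H

/-- The Woodbury identity: it turns the precision form of the posterior covariance into the gain
form used by the Kalman filter. -/
theorem inv_one_add_transpose_mul_mul (H : Matrix (Fin e) (Fin d) ℝ)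
    {Γ : Matrix (Fin e) (Fin e) ℝ} (hΓ : Γ.PosDef) (hS : (H * Hᵀ + Γ).PosDef) :
    (1 + Hᵀ * Γ⁻¹ * H)⁻¹ = 1 - Hᵀ * (H * Hᵀ + Γ)⁻¹ * H := by
  set S := H * Hᵀ + Γ with hSdef
  refine inv_eq_right_inv ?_
  have h1 : H * Hᵀ = S - Γ := by rw [hSdef, add_sub_cancel_right]
  have h2 : Hᵀ * Γ⁻¹ * H * (Hᵀ * S⁻¹ * H) = Hᵀ * Γ⁻¹ * H - Hᵀ * S⁻¹ * H := by
    calc Hᵀ * Γ⁻¹ * H * (Hᵀ * S⁻¹ * H) = Hᵀ * (Γ⁻¹ * (H * Hᵀ) * S⁻¹) * H := by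
          simp only [Matrix.mul_assoc]
      _ = _ := by
          rw [h1, Matrix.mul_sub, Matrix.nonsing_inv_mul _ (posDef_isUnit_det hΓ),
            Matrix.sub_mul, Matrix.mul_assoc Γ⁻¹, Matrix.mul_nonsing_inv _ (posDef_isUnit_det hS)]
          simp only [Matrix.mul_sub, Matrix.sub_mul, Matrix.mul_one, Matrix.one_mul]
  rw [Matrix.add_mul, Matrix.mul_sub, Matrix.mul_sub, h2]
  simp

theorem posDef_residualCov {P : Matrix (Fin d) (Fin d) ℝ} (hP : P.PosSemidef)
    (C : Matrix (Fin e) (Fin d) ℝ) {Γ : Matrix (Fin e) (Fin e) ℝ} (hΓ : Γ.PosDef) :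
    (C * P * Cᵀ + Γ).PosDef :=
  hΓ.posSemidef_add (posSemidef_mul_mul_transpose hP C)

/-- If `P = L Lᵀ` and `H = C L`, the difference equals `L (1 + Hᵀ Γ⁻¹ H)⁻¹ Lᵀ`, which is visibly
semidefinite. -/
theorem posSemidef_posteriorCov {P : Matrix (Fin d) (Fin d) ℝ} (hP : P.PosSemidef)
    (C : Matrix (Fin e) (Fin d) ℝ) {Γ : Matrix (Fin e) (Fin e) ℝ} (hΓ : Γ.PosDef) :
    (P - P * Cᵀ * (C * P * Cᵀ + Γ)⁻¹ * C * P).PosSemidef := by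
  obtain ⟨L, hL⟩ := exists_eq_mul_transpose hP
  have hS := posDef_residualCov hP C hΓ
  have hSe : C * P * Cᵀ + Γ = (C * L) * (C * L)ᵀ + Γ := by
    rw [hL, transpose_mul]
    simp only [Matrix.mul_assoc]
  rw [hSe] at hS ⊢
  have h := posSemidef_mul_mul_transpose
    (posDef_one_add_transpose_mul_mul (C * L) hΓ).inv.posSemidef L
  rw [inv_one_add_transpose_mul_mul _ hΓ hS] at h
  convert h using 1
  rw [Matrix.mul_sub, Matrix.sub_mul, mul_one, hL, transpose_mul]
  simp only [Matrix.mul_assoc]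

/-- Conditioning a Gaussian law on a linear observation with Gaussian noise. -/
theorem lintegral_mul_gaussianDensity_gaussVec (m : Fin d → ℝ) {P : Matrix (Fin d) (Fin d) ℝ}
    (hP : P.PosSemidef) (C : Matrix (Fin e) (Fin d) ℝ) {Γ : Matrix (Fin e) (Fin e) ℝ}
    (hΓ : Γ.PosDef) (y : Fin e → ℝ) {g : (Fin d → ℝ) → ENNReal} (hg : Measurable g) :
    ∫⁻ x, g x * ENNReal.ofReal (gaussianDensity (C *ᵥ x) Γ y) ∂gaussVec m P
      = ENNReal.ofReal (gaussianDensity (C *ᵥ m) (C * P * Cᵀ + Γ) y)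
        * ∫⁻ x, g x ∂gaussVec (m + (P * Cᵀ * (C * P * Cᵀ + Γ)⁻¹) *ᵥ (y - C *ᵥ m))
            (P - P * Cᵀ * (C * P * Cᵀ + Γ)⁻¹ * C * P) := by
  obtain ⟨L, hL⟩ := exists_eq_mul_transpose hP
  set H := C * L with hH
  have hSe : C * P * Cᵀ + Γ = H * Hᵀ + Γ := by
    rw [hH, hL, transpose_mul]
    simp only [Matrix.mul_assoc]
  have hS : (C * P * Cᵀ + Γ).PosDef :=
    posDef_residualCov hP C hΓ
  rw [hSe] at hS ⊢
  have hΛ := posDef_one_add_transpose_mul_mul H hΓ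
  set S := H * Hᵀ + Γ with hSdef
  set Λ := 1 + Hᵀ * Γ⁻¹ * H with hΛdef
  have hm1 := map_affine_gaussVec (0 : Fin d → ℝ) (PosSemidef.one) m L
  rw [mulVec_zero, add_zero, mul_one, ← hL] at hm1
  have hψ : Measurable (fun x : Fin d → ℝ => m + L *ᵥ x) := by fun_prop
  have hΛi : Λ⁻¹ = 1 - Hᵀ * S⁻¹ * H := inv_one_add_transpose_mul_mul H hΓ hS
  have hm2 := map_affine_gaussVec (Hᵀ *ᵥ (S⁻¹ *ᵥ (y - C *ᵥ m))) hΛ.inv.posSemidef m L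
  -- The whitened posterior moments, transported by `ξ ↦ m + L ξ`, become the Kalman update.
  have hmean : m + L *ᵥ (Hᵀ *ᵥ (S⁻¹ *ᵥ (y - C *ᵥ m)))
      = m + (P * Cᵀ * S⁻¹) *ᵥ (y - C *ᵥ m) := by
    simp only [hH, hL, mulVec_mulVec, transpose_mul, Matrix.mul_assoc]
  have hcov : L * Λ⁻¹ * Lᵀ = P - P * Cᵀ * S⁻¹ * C * P := by
    rw [hΛi, Matrix.mul_sub, Matrix.sub_mul, mul_one, hH, hL, transpose_mul]
    simp only [Matrix.mul_assoc]
  rw [hmean, hcov] at hm2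
  have hden : Measurable (fun x : Fin d → ℝ => ENNReal.ofReal (gaussianDensity (C *ᵥ x) Γ y)) :=
    (measurable_gaussianDensity_comp (measurable_mulVec C) measurable_const Γ).ennreal_ofReal
  -- `P` may be singular, so `gaussVec m P` need not have a density. Both integrals are moved to the
  -- coordinate `ξ`, where Bayes' rule holds pointwise.
  rw [← hm1, ← hm2, lintegral_map (show Measurable fun x => g x * _ from hg.mul hden) hψ, lintegral_map hg hψ,
    gaussVec_zero_one_eq_withDensity, gaussVec_eq_withDensity _ hΛ.inv]
  have hm3 : Measurable (fun x => g (m + L *ᵥ x)) := hg.comp hψ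
  rw [lintegral_withDensity_eq_lintegral_mul _ (measurable_gaussianDensity _ _).ennreal_ofReal
      (show Measurable fun x => g (m + L *ᵥ x) * _ from (hg.mul hden).comp hψ),
    lintegral_withDensity_eq_lintegral_mul _ (measurable_gaussianDensity _ _).ennreal_ofReal hm3,
    ← lintegral_const_mul _ ((measurable_gaussianDensity _ _).ennreal_ofReal.mul hm3)]
  refine lintegral_congr fun ξ => ?_
  have hk := gaussianDensity_add_mul (y := y) (C *ᵥ m) H hΓ hS hΛ ξ
  have hk' : C *ᵥ (m + L *ᵥ ξ) = C *ᵥ m + H *ᵥ ξ := by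
    rw [mulVec_add, mulVec_mulVec]
  simp only [Pi.mul_apply]
  rw [hk', mul_left_comm, mul_comm (ENNReal.ofReal _) (ENNReal.ofReal _),
    ← ENNReal.ofReal_mul (gaussianDensity_pos _ hΓ _).le, hk,
    ENNReal.ofReal_mul (gaussianDensity_pos _ hS _).le]
  ring

end


/-! ### Independence of triples and freezing of independent variables. -/

section Independence

variable {Ω α β γ : Type*} [MeasurableSpace Ω] [MeasurableSpace α] [MeasurableSpace β]
  [MeasurableSpace γ] {P : Measure Ω} [IsProbabilityMeasure P] {X : Ω → α} {Y : Ω → β} {Z : Ω → γ}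

/-- The two hypotheses make the joint law a threefold product, which can be regrouped by
associativity. -/
theorem indepFun_prodMk_left (hX : AEMeasurable X P) (hY : AEMeasurable Y P)
    (hZ : AEMeasurable Z P) (h : IndepFun X (fun ω => (Y ω, Z ω)) P) (h' : IndepFun Y Z P) :
    IndepFun (fun ω => (X ω, Y ω)) Z P := by
  have hXY : IndepFun X Y P := h.comp measurable_id measurable_fst
  have := Measure.isProbabilityMeasure_map hX
  have := Measure.isProbabilityMeasure_map hY
  have := Measure.isProbabilityMeasure_map hZ
  rw [indepFun_iff_map_prod_eq_prod_map_map (hX.prodMk hY) hZ, hXY.map_prod_eq_prod_map_map hX hY]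
  have h1 := h.map_prod_eq_prod_map_map hX (hY.prodMk hZ)
  rw [h'.map_prod_eq_prod_map_map hY hZ] at h1
  have h2 := (measurePreserving_prodAssoc (P.map X) (P.map Y) (P.map Z)).symm
  rw [← h2.map_eq, ← h1, AEMeasurable.map_map_of_aemeasurable h2.measurable.aemeasurable
    (hX.prodMk (hY.prodMk hZ))]
  rfl

theorem lintegral_comp_indepFun (hX : AEMeasurable X P) (hY : AEMeasurable Y P)
    (h : IndepFun X Y P) {F : α × β → ENNReal} (hF : Measurable F) :
    ∫⁻ ω, F (X ω, Y ω) ∂P = ∫⁻ ω, ∫⁻ y, F (X ω, y) ∂(P.map Y) ∂P := by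
  have := Measure.isProbabilityMeasure_map hY
  rw [← lintegral_map' (μ := P) (f := F) hF.aemeasurable (hX.prodMk hY),
    h.map_prod_eq_prod_map_map hX hY, lintegral_prod _ hF.aemeasurable,
    lintegral_map' hF.lintegral_prod_right'.aemeasurable hX]

end Independence

/-! ### State process, unnormalized filter and likelihood. -/

noncomputable section

variable {ι : Type*} {dx du dy : ℕ}

namespace Model

/-- Exhibits the state as a fixed function of `(x0, w)`. The noises are only almost everywhere
measurable, so measurability is proved for this function on the canonical space and then composed.
-/
theorem state_eq_canonical {Ω : Type*} (M : Model ι dx du dy) (x0 : Ω → Fin dx → ℝ)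
    (w : ℕ → Ω → Fin dx → ℝ) (θ : ι → ℝ) (ω : Ω) (t : ℕ) :
    M.state x0 w θ ω t = M.state Prod.fst (fun s (p : (Fin dx → ℝ) × (ℕ → Fin dx → ℝ)) => p.2 s) θ (x0 ω, fun s => w s ω) t := by
  induction t with
  | zero => rfl
  | succ t ih => simp only [state, ih]

theorem measurable_state {Ω : Type*} [MeasurableSpace Ω] (M : Model ι dx du dy)
    {x0 : Ω → Fin dx → ℝ} {w : ℕ → Ω → Fin dx → ℝ} (hx : Measurable x0)
    (hw : ∀ t, Measurable (w t)) (θ : ι → ℝ) (t : ℕ) :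
    Measurable (fun ω => M.state x0 w θ ω t) := by
  induction t with
  | zero => exact hx
  | succ t ih =>
    simp only [state]
    have := (measurable_mulVec (M.A θ)).comp ih
    exact (this.add_const _).add (hw t)

/-- Used to view past states as functions of the finite history `(x0, w_0, …, w_{t-1})`, which is
independent of `w_t`. -/
theorem state_congr {Ω Ω' : Type*} (M : Model ι dx du dy) {x0 : Ω → Fin dx → ℝ}
    {w : ℕ → Ω → Fin dx → ℝ} {x0' : Ω' → Fin dx → ℝ} {w' : ℕ → Ω' → Fin dx → ℝ} (θ : ι → ℝ)
    {ω : Ω} {ω' : Ω'} {t : ℕ} (h0 : x0 ω = x0' ω') (hw : ∀ s < t, w s ω = w' s ω') {s : ℕ}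
    (hs : s ≤ t) : M.state x0 w θ ω s = M.state x0' w' θ ω' s := by
  induction s with
  | zero => exact h0
  | succ s ih => simp only [state, ih (by omega), hw s (by omega)]

theorem posSemidef_predictCov {M : Model ι dx du dy} (hw : M.procCov.PosSemidef) (θ : ι → ℝ)
    {P : Matrix (Fin dx) (Fin dx) ℝ} (hP : P.PosSemidef) : (M.predictCov θ P).PosSemidef :=
  (posSemidef_mul_mul_transpose hP _).add hw

theorem posSemidef_filtCov {M : Model ι dx du dy} (h0 : M.initCov.PosSemidef)
    (hw : M.procCov.PosSemidef) (hz : M.measCov.PosDef) (θ : ι → ℝ) (t : ℕ) :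
    (M.filtCov θ t).PosSemidef := by
  induction t with
  | zero => exact h0
  | succ t ih => exact posSemidef_posteriorCov (posSemidef_predictCov hw θ ih) (M.C θ) hz

theorem posSemidef_predCov {M : Model ι dx du dy} (h0 : M.initCov.PosSemidef)
    (hw : M.procCov.PosSemidef) (hz : M.measCov.PosDef) (θ : ι → ℝ) (t : ℕ) :
    (M.predCov θ t).PosSemidef :=
  posSemidef_predictCov hw θ (posSemidef_filtCov h0 hw hz θ t)

theorem posDef_innovCov {M : Model ι dx du dy} (h0 : M.initCov.PosSemidef)
    (hw : M.procCov.PosSemidef) (hz : M.measCov.PosDef) (θ : ι → ℝ) (t : ℕ) :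
    (M.innovCov θ t).PosDef :=
  posDef_residualCov (posSemidef_predCov h0 hw hz θ t) (M.C θ) hz

end Model

section Noise

variable {Ω : Type*} [MeasurableSpace Ω] {P : Measure Ω}
  {M : Model ι dx du dy} {x0 : Ω → Fin dx → ℝ} {w : ℕ → Ω → Fin dx → ℝ} {z : ℕ → Ω → Fin dy → ℝ}

namespace IsNoise

theorem aemeasurable_init (h : IsNoise M P x0 w z) : AEMeasurable x0 P :=
  (isGaussianVector_iff_map h.law_init).1

theorem aemeasurable_proc (h : IsNoise M P x0 w z) (t : ℕ) : AEMeasurable (w t) P :=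
  (isGaussianVector_iff_map (h.law_proc t)).1

theorem aemeasurable_meas (h : IsNoise M P x0 w z) (t : ℕ) : AEMeasurable (z t) P :=
  (isGaussianVector_iff_map (h.law_meas t)).1

theorem aemeasurable_proc_seq (h : IsNoise M P x0 w z) : AEMeasurable (fun ω t => w t ω) P :=
  aemeasurable_pi_lambda _ h.aemeasurable_proc

theorem aemeasurable_meas_seq (h : IsNoise M P x0 w z) : AEMeasurable (fun ω t => z t ω) P :=
  aemeasurable_pi_lambda _ h.aemeasurable_meas

theorem indepFun_history_proc [IsProbabilityMeasure P] (h : IsNoise M P x0 w z) (t : ℕ) :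
    IndepFun (fun ω => (x0 ω, fun s : Finset.range t => w s ω)) (w t) P := by
  have h1 := h.indep_proc.indepFun_finset₀ (Finset.range t) {t} (by simp) h.aemeasurable_proc
  have h2 : IndepFun (fun ω => fun s : Finset.range t => w s ω) (w t) P :=
    h1.comp measurable_id (measurable_pi_apply (⟨t, Finset.mem_singleton_self t⟩ : ({t} : Finset ℕ)))
  have h3 : IndepFun x0 (fun ω => ((fun s : Finset.range t => w s ω), w t ω)) P :=
    h.indep_init.comp measurable_id
      (show Measurable fun p : (ℕ → Fin dx → ℝ) × (ℕ → Fin dy → ℝ) =>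
        ((fun s : Finset.range t => p.1 s), p.1 t) by fun_prop)
  exact indepFun_prodMk_left h.aemeasurable_init
    (aemeasurable_pi_lambda _ fun s => h.aemeasurable_proc s) (h.aemeasurable_proc t) h3 h2

theorem indepFun_states_meas [IsProbabilityMeasure P] (h : IsNoise M P x0 w z) :
    IndepFun (fun ω => (x0 ω, fun t => w t ω)) (fun ω t => z t ω) P :=
  indepFun_prodMk_left h.aemeasurable_init h.aemeasurable_proc_seq h.aemeasurable_meas_seq
    h.indep_init h.indep_proc_meas

theorem aemeasurable_state (h : IsNoise M P x0 w z) (θ : ι → ℝ) (t : ℕ) :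
    AEMeasurable (fun ω => M.state x0 w θ ω t) P := by
  simp_rw [M.state_eq_canonical x0 w]
  exact (M.measurable_state measurable_fst (fun t => by fun_prop) θ t).comp_aemeasurable
    (h.aemeasurable_init.prodMk h.aemeasurable_proc_seq)

end IsNoise

namespace Model

/-- The prediction step of the filter: an affine image, then convolution with the process noise. -/
theorem lintegral_predict_gaussVec (hw : M.procCov.PosSemidef) (θ : ι → ℝ) (b m : Fin dx → ℝ)
    {Q : Matrix (Fin dx) (Fin dx) ℝ} (hQ : Q.PosSemidef) {g : (Fin dx → ℝ) → ENNReal}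
    (hg : Measurable g) :
    ∫⁻ x, ∫⁻ v, g (M.A θ *ᵥ x + b + v) ∂gaussVec 0 M.procCov ∂gaussVec m Q
      = ∫⁻ x, g x ∂gaussVec (M.A θ *ᵥ m + b) (M.predictCov θ Q) := by
  have h1 := map_affine_gaussVec m hQ b (M.A θ)
  have h2 := map_add_gaussVec (b + M.A θ *ᵥ m) 0 (posSemidef_mul_mul_transpose hQ (M.A θ)) hw
  rw [add_zero] at h2
  have hm : Measurable (fun x : Fin dx → ℝ => b + M.A θ *ᵥ x) := by fun_prop
  have hg2 : Measurable (fun p : (Fin dx → ℝ) × (Fin dx → ℝ) => g (p.1 + p.2)) :=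
    hg.comp (by fun_prop)
  rw [predictCov, add_comm _ b, ← h2, lintegral_map hg (by fun_prop),
    lintegral_prod _ hg2.aemeasurable, ← h1, lintegral_map hg2.lintegral_prod_right' hm]
  simp_rw [add_comm _ b]

variable [IsProbabilityMeasure P]

/-- The unnormalized filter: the joint weight of the state and the past observations. -/
theorem lintegral_state_mul_prod (h0 : M.initCov.PosSemidef) (hw : M.procCov.PosSemidef)
    (hz : M.measCov.PosDef) (h : IsNoise M P x0 w z) {T : ℕ} (θ : ι → ℝ)
    (y : Fin T → Fin dy → ℝ) (t : ℕ) {g : (Fin dx → ℝ) → ENNReal} (hg : Measurable g) :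
    ∫⁻ ω, g (M.state x0 w θ ω t) * ∏ s ∈ Finset.range t, ENNReal.ofReal
        (gaussianDensity (M.C θ *ᵥ M.state x0 w θ ω (s + 1)) M.measCov (obs y s)) ∂P
      = (∏ s ∈ Finset.range t, ENNReal.ofReal
          (gaussianDensity (M.C θ *ᵥ M.predMean θ y s) (M.innovCov θ s) (obs y s)))
        * ∫⁻ x, g x ∂gaussVec (M.filtMean θ y t) (M.filtCov θ t) := by
  -- `g` must vary: the induction hypothesis is applied to a test function that already contains the
  -- new observation density, averaged over the process noise.
  induction t generalizing g with
  | zero =>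
    obtain ⟨hm, hl⟩ := isGaussianVector_iff_map h.law_init
    simp only [Finset.range_zero, Finset.prod_empty, mul_one, one_mul, state, filtMean, filtCov]
    rw [← hl, lintegral_map' hg.aemeasurable hm]
  | succ t ih =>
    -- The state recursion driven by the finite noise history. The noise is padded by zero from time
    -- `t` on, which states up to time `t` never see.
    set φ : ((Fin dx → ℝ) × (Finset.range t → Fin dx → ℝ)) → ℕ → Fin dx → ℝ := fun p s =>
      M.state Prod.fst
        (fun s (p : (Fin dx → ℝ) × (Finset.range t → Fin dx → ℝ)) => if hs : s ∈ Finset.range t then p.2 ⟨s, hs⟩ else 0) θ p s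
      with hφdef
    have hφ : ∀ s, Measurable (fun p => φ p s) := fun s =>
      M.measurable_state measurable_fst (fun s => by
        by_cases hs : s ∈ Finset.range t
        · simp only [hs, dite_true]; fun_prop
        · simp only [hs, dite_false]; fun_prop) θ s
    have hφs : ∀ ω, ∀ s ≤ t, M.state x0 w θ ω s
        = φ (x0 ω, fun s : Finset.range t => w s ω) s := by
      intro ω s hs
      refine M.state_congr (ω := ω) (ω' := (x0 ω, fun s : Finset.range t => w s ω)) θ (t := t)
        rfl (fun r hr => ?_) hs
      simp [hr]
    set b := M.B θ *ᵥ M.input t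
    set gy : (Fin dx → ℝ) → ENNReal := fun x =>
      g x * ENNReal.ofReal (gaussianDensity (M.C θ *ᵥ x) M.measCov (obs y t)) with hgy
    have hgym : Measurable gy := hg.mul (measurable_gaussianDensity_comp (measurable_mulVec _)
      measurable_const _).ennreal_ofReal
    have hprodm : Measurable (fun p => ∏ s ∈ Finset.range t, ENNReal.ofReal
        (gaussianDensity (M.C θ *ᵥ φ p (s + 1)) M.measCov (obs y s))) :=
      Finset.measurable_prod _ fun s _ => (measurable_gaussianDensity_comp
        ((measurable_mulVec _).comp (hφ _)) measurable_const _).ennreal_ofReal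
    have hprod : ∀ ω, ∏ s ∈ Finset.range t, ENNReal.ofReal
        (gaussianDensity (M.C θ *ᵥ M.state x0 w θ ω (s + 1)) M.measCov (obs y s))
        = ∏ s ∈ Finset.range t, ENNReal.ofReal (gaussianDensity
          (M.C θ *ᵥ φ (x0 ω, fun s : Finset.range t => w s ω) (s + 1)) M.measCov (obs y s)) := by
      intro ω
      refine Finset.prod_congr rfl fun s hs => ?_
      rw [hφs ω (s + 1) (Finset.mem_range.mp hs)]
    have hG : Measurable (fun q : (Fin dx → ℝ) × (Fin dx → ℝ) => gy (M.A θ *ᵥ q.1 + b + q.2)) :=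
      hgym.comp ((((measurable_mulVec _).comp measurable_fst).add_const b).add measurable_snd)
    have hF : Measurable (fun q : ((Fin dx → ℝ) × (Finset.range t → Fin dx → ℝ)) × (Fin dx → ℝ) =>
        gy (M.A θ *ᵥ φ q.1 t + b + q.2) * ∏ s ∈ Finset.range t, ENNReal.ofReal
          (gaussianDensity (M.C θ *ᵥ φ q.1 (s + 1)) M.measCov (obs y s))) :=
      (hG.comp (((hφ t).comp measurable_fst).prodMk measurable_snd)).mul
        (hprodm.comp measurable_fst)
    have hstep := lintegral_comp_indepFun
      (h.aemeasurable_init.prodMk (aemeasurable_pi_lambda _ fun s : Finset.range t =>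
        h.aemeasurable_proc s)) (h.aemeasurable_proc t) (h.indepFun_history_proc t) hF
    rw [(isGaussianVector_iff_map (h.law_proc t)).2] at hstep
    simp only [← hprod, ← hφs _ t le_rfl] at hstep
    have hb := lintegral_mul_gaussianDensity_gaussVec (M.predMean θ y t)
      (posSemidef_predCov h0 hw hz θ t) (M.C θ) hz (obs y t) hg
    calc _ = ∫⁻ ω, gy (M.A θ *ᵥ M.state x0 w θ ω t + b + w t ω) * ∏ s ∈ Finset.range t,
          ENNReal.ofReal (gaussianDensity (M.C θ *ᵥ M.state x0 w θ ω (s + 1)) M.measCov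
            (obs y s)) ∂P := by
          refine lintegral_congr fun ω => ?_
          rw [Finset.prod_range_succ, hgy]
          simp only [state]
          ring
      _ = _ := hstep
      _ = ∫⁻ ω, (∫⁻ v, gy (M.A θ *ᵥ M.state x0 w θ ω t + b + v) ∂gaussVec 0 M.procCov)
          * ∏ s ∈ Finset.range t, ENNReal.ofReal
            (gaussianDensity (M.C θ *ᵥ M.state x0 w θ ω (s + 1)) M.measCov (obs y s)) ∂P := by
          refine lintegral_congr fun ω => ?_
          rw [lintegral_mul_const]
          exact hgym.comp (measurable_const_add _)
      _ = _ := ih (g := fun x => ∫⁻ v, gy (M.A θ *ᵥ x + b + v) ∂gaussVec 0 M.procCov)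
          hG.lintegral_prod_right'
      _ = _ := by
          rw [lintegral_predict_gaussVec hw θ b _ (posSemidef_filtCov h0 hw hz θ t) hgym]
          rw [Finset.prod_range_succ, mul_assoc]
          -- What remains is `hb`, the Bayes update, up to unfolding the filter recursions.
          congr 1

theorem obs_fin {T : ℕ} (y : Fin T → Fin dy → ℝ) (t : Fin T) : obs y t = y t := by
  simp [obs]

theorem lintegral_prod_gaussianDensity (h0 : M.initCov.PosSemidef) (hw : M.procCov.PosSemidef)
    (hz : M.measCov.PosDef) (h : IsNoise M P x0 w z) {T : ℕ} (θ : ι → ℝ)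
    (y : Fin T → Fin dy → ℝ) :
    ∫⁻ ω, ENNReal.ofReal
        (∏ t : Fin T, gaussianDensity (M.C θ *ᵥ M.state x0 w θ ω (t + 1)) M.measCov (y t)) ∂P
      = ENNReal.ofReal (∏ t ∈ Finset.range T,
          gaussianDensity (M.C θ *ᵥ M.predMean θ y t) (M.innovCov θ t) (obs y t)) := by
  have h1 := lintegral_state_mul_prod h0 hw hz h θ y T (g := fun _ => 1) measurable_const
  simp only [one_mul, lintegral_one, measure_univ, mul_one] at h1
  rw [ENNReal.ofReal_prod_of_nonneg fun t _ =>
    (gaussianDensity_pos _ (posDef_innovCov h0 hw hz θ t) _).le, ← h1]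
  refine lintegral_congr fun ω => ?_
  rw [ENNReal.ofReal_prod_of_nonneg fun t _ => (gaussianDensity_pos _ hz _).le,
    Finset.prod_range]
  simp_rw [obs_fin]

/-- The prediction error decomposition of the likelihood. -/
theorem likelihood_eq_prod (h0 : M.initCov.PosSemidef) (hw : M.procCov.PosSemidef)
    (hz : M.measCov.PosDef) (h : IsNoise M P x0 w z) {T : ℕ} (θ : ι → ℝ)
    (y : Fin T → Fin dy → ℝ) :
    M.likelihood T P x0 w θ y = ∏ t ∈ Finset.range T,
      gaussianDensity (M.C θ *ᵥ M.predMean θ y t) (M.innovCov θ t) (obs y t) := by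
  have hm : AEMeasurable (fun ω => ∏ t : Fin T,
      gaussianDensity (M.C θ *ᵥ M.state x0 w θ ω (t + 1)) M.measCov (y t)) P :=
    Finset.aemeasurable_fun_prod _ fun t _ => (measurable_gaussianDensity_comp
      (measurable_mulVec (M.C θ)) measurable_const M.measCov).comp_aemeasurable
        (h.aemeasurable_state θ (t + 1))
  rw [likelihood, integral_eq_lintegral_of_nonneg_ae
    (ae_of_all _ fun ω => Finset.prod_nonneg fun t _ => (gaussianDensity_pos _ hz _).le)
    hm.aestronglyMeasurable, lintegral_prod_gaussianDensity h0 hw hz h, ENNReal.toReal_ofReal]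
  exact Finset.prod_nonneg fun t _ => (gaussianDensity_pos _ (posDef_innovCov h0 hw hz θ t) _).le

theorem likelihood_pos (h0 : M.initCov.PosSemidef) (hw : M.procCov.PosSemidef)
    (hz : M.measCov.PosDef) (h : IsNoise M P x0 w z) {T : ℕ} (θ : ι → ℝ)
    (y : Fin T → Fin dy → ℝ) : 0 < M.likelihood T P x0 w θ y := by
  rw [likelihood_eq_prod h0 hw hz h]
  exact Finset.prod_pos fun t _ => gaussianDensity_pos _ (posDef_innovCov h0 hw hz θ t) _

theorem log_gaussianDensity {d : ℕ} (m : Fin d → ℝ) {S : Matrix (Fin d) (Fin d) ℝ} (hS : S.PosDef)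
    (v : Fin d → ℝ) : Real.log (gaussianDensity m S v)
      = -((d : ℝ) / 2) * Real.log (2 * Real.pi)
        - (1 / 2) * (Real.log S.det + (v - m) ⬝ᵥ (S⁻¹ *ᵥ (v - m))) := by
  have h1 := hS.det_pos
  have h2 : (0 : ℝ) < (2 * Real.pi) ^ d * S.det := by positivity
  rw [gaussianDensity, Real.log_mul (by positivity) (Real.exp_pos _).ne', Real.log_exp,
    Real.log_inv, Real.log_sqrt h2.le, Real.log_mul (by positivity) h1.ne', Real.log_pow]
  ring

theorem logLikelihood_eq (h0 : M.initCov.PosSemidef) (hw : M.procCov.PosSemidef)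
    (hz : M.measCov.PosDef) (h : IsNoise M P x0 w z) {T : ℕ} (θ : ι → ℝ)
    (y : Fin T → Fin dy → ℝ) :
    M.logLikelihood T P x0 w θ y = -((T : ℝ) * (dy : ℝ) / 2) * Real.log (2 * Real.pi)
      - (1 / 2) * ∑ t ∈ Finset.range T, (Real.log (M.innovCov θ t).det
          + M.innov θ y t ⬝ᵥ ((M.innovCov θ t)⁻¹ *ᵥ M.innov θ y t)) := by
  rw [logLikelihood, likelihood_eq_prod h0 hw hz h, Real.log_prod fun t _ =>
    (gaussianDensity_pos _ (posDef_innovCov h0 hw hz θ t) _).ne']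
  simp_rw [log_gaussianDensity _ (posDef_innovCov h0 hw hz θ _)]
  rw [Finset.sum_sub_distrib, Finset.sum_const, Finset.card_range, ← Finset.mul_sum, nsmul_eq_mul]
  simp only [innov]
  ring

theorem map_pi_meas (hz : M.measCov.PosDef) (h : IsNoise M P x0 w z) (T : ℕ) :
    P.map (fun ω (t : Fin T) => z (t + 1) ω) = volume.withDensity (fun ζ : Fin T → Fin dy → ℝ =>
      ∏ t, ENNReal.ofReal (gaussianDensity 0 M.measCov (ζ t))) := by
  have h1 : iIndepFun (fun t : Fin T => z ((t : ℕ) + 1)) P :=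
    h.indep_meas.precomp fun a b hab => Fin.ext (by simpa using hab)
  have h2 := (iIndepFun_iff_map_fun_eq_pi_map fun t : Fin T => h.aemeasurable_meas (t + 1)).mp h1
  rw [h2]
  have h3 : ∀ t : Fin T, P.map (z ((t : ℕ) + 1))
      = volume.withDensity (fun v => ENNReal.ofReal (gaussianDensity 0 M.measCov v)) := fun t => by
    rw [(isGaussianVector_iff_map (h.law_meas _)).2, gaussVec_eq_withDensity _ hz]
  simp_rw [h3]
  rw [pi_withDensity _ _ (fun _ => (measurable_gaussianDensity _ _).ennreal_ofReal) fun t => by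
    rw [← gaussVec_eq_withDensity _ hz]; infer_instance]
  rfl

theorem gaussianDensity_sub {d : ℕ} (c v : Fin d → ℝ) (S : Matrix (Fin d) (Fin d) ℝ) :
    gaussianDensity 0 S (v - c) = gaussianDensity c S v := by
  simp [gaussianDensity]

/-- With the state path frozen, the outputs are a translate of the measurement noise, whose density
is `D`. Averaging over paths and exchanging the integrals turns `D` into the likelihood. -/
theorem outputLaw_eq_withDensity (h0 : M.initCov.PosSemidef) (hw : M.procCov.PosSemidef)
    (hz : M.measCov.PosDef) (h : IsNoise M P x0 w z) (T : ℕ) (θ : ι → ℝ) :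
    M.outputLaw T P x0 w z θ =
      volume.withDensity (fun y => ENNReal.ofReal (M.likelihood T P x0 w θ y)) := by
  set Q := P.map (fun ω => (x0 ω, fun t => w t ω)) with hQ
  have hxw := h.aemeasurable_init.prodMk h.aemeasurable_proc_seq
  have := Measure.isProbabilityMeasure_map hxw
  set φ : ((Fin dx → ℝ) × (ℕ → Fin dx → ℝ)) → ℕ → Fin dx → ℝ := fun p s =>
    M.state Prod.fst (fun s (p : (Fin dx → ℝ) × (ℕ → Fin dx → ℝ)) => p.2 s) θ p s with hφdef
  have hφ : ∀ s, Measurable (fun p => φ p s) := fun s =>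
    M.measurable_state measurable_fst (fun s => by fun_prop) θ s
  set c : ((Fin dx → ℝ) × (ℕ → Fin dx → ℝ)) → Fin T → Fin dy → ℝ := fun p t =>
    M.C θ *ᵥ φ p (t + 1) with hc
  have hcm : Measurable c := measurable_pi_lambda _ fun t => (measurable_mulVec _).comp (hφ _)
  set D : ((Fin dx → ℝ) × (ℕ → Fin dx → ℝ)) × (Fin T → Fin dy → ℝ) → ENNReal := fun q =>
    ∏ t, ENNReal.ofReal (gaussianDensity (c q.1 t) M.measCov (q.2 t)) with hD
  have hDm : Measurable D := Finset.measurable_prod _ fun t _ =>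
    (measurable_gaussianDensity_comp (by fun_prop) (by fun_prop) _).ennreal_ofReal
  -- The Bochner integral and the Lebesgue integral are identified through their common value, the
  -- product of innovation densities.
  have hlik : ∀ y, ENNReal.ofReal (M.likelihood T P x0 w θ y) = ∫⁻ p, D (p, y) ∂Q := by
    intro y
    rw [likelihood_eq_prod h0 hw hz h, ← lintegral_prod_gaussianDensity h0 hw hz h,
      hQ, lintegral_map' (by
        have : Measurable fun p => D (p, y) := by fun_prop
        exact this.aemeasurable) hxw]
    refine lintegral_congr fun ω => ?_
    rw [ENNReal.ofReal_prod_of_nonneg fun t _ => (gaussianDensity_pos _ hz _).le]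
    simp only [hD, hc, hφdef, ← M.state_eq_canonical x0 w]
  have hzm : AEMeasurable (fun ω (t : Fin T) => z (t + 1) ω) P :=
    aemeasurable_pi_lambda _ fun t => h.aemeasurable_meas _
  have hind : IndepFun (fun ω => (x0 ω, fun t => w t ω)) (fun ω (t : Fin T) => z (t + 1) ω) P :=
    h.indepFun_states_meas.comp measurable_id
      (show Measurable fun (ζ : ℕ → Fin dy → ℝ) (t : Fin T) => ζ (t + 1) by fun_prop)
  have hout : M.output T x0 w z θ
      = fun ω => c (x0 ω, fun t => w t ω) + fun t : Fin T => z (t + 1) ω := by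
    funext ω t
    simp only [output, hc, hφdef, Pi.add_apply, ← M.state_eq_canonical x0 w]
  have houtm : AEMeasurable (M.output T x0 w z θ) P := by
    rw [hout]
    exact (hcm.comp_aemeasurable hxw).add hzm
  refine Measure.ext_of_lintegral _ fun f hf => ?_
  have hzd : Measurable (fun ζ : Fin T → Fin dy → ℝ =>
      ∏ t, ENNReal.ofReal (gaussianDensity 0 M.measCov (ζ t))) :=
    Finset.measurable_prod _ fun t _ =>
      (measurable_gaussianDensity_comp (by fun_prop) (by fun_prop) _).ennreal_ofReal
  have hF : Measurable (fun q : ((Fin dx → ℝ) × (ℕ → Fin dx → ℝ)) × (Fin T → Fin dy → ℝ) =>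
    f (c q.1 + q.2)) := hf.comp (by fun_prop)
  have hlm : Measurable (fun y => ENNReal.ofReal (M.likelihood T P x0 w θ y)) := by
    simp_rw [hlik]
    exact (hDm.comp measurable_swap).lintegral_prod_right'
  calc ∫⁻ y, f y ∂M.outputLaw T P x0 w z θ
      = ∫⁻ ω, f (c (x0 ω, fun t => w t ω) + fun t : Fin T => z (t + 1) ω) ∂P := by
        rw [outputLaw, lintegral_map' hf.aemeasurable houtm, hout]
    _ = ∫⁻ ω, ∫⁻ ζ, f (c (x0 ω, fun t => w t ω) + ζ)
          ∂(P.map fun ω (t : Fin T) => z (t + 1) ω) ∂P :=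
        lintegral_comp_indepFun hxw hzm hind hF
    _ = ∫⁻ ω, ∫⁻ y, D ((x0 ω, fun t => w t ω), y) * f y ∂volume ∂P := by
        refine lintegral_congr fun ω => ?_
        have hfc : Measurable fun ζ => f (c (x0 ω, fun t => w t ω) + ζ) :=
          hf.comp (measurable_const_add _)
        -- Translation invariance of Lebesgue measure, with the substitution `ζ = y - c`.
        rw [map_pi_meas hz h, lintegral_withDensity_eq_lintegral_mul _ hzd hfc,
          ← lintegral_sub_right_eq_self _ (c (x0 ω, fun t => w t ω))]
        refine lintegral_congr fun y => ?_
        simp only [Pi.mul_apply, Pi.sub_apply, gaussianDensity_sub, add_sub_cancel, hD]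
    _ = ∫⁻ p, ∫⁻ y, D (p, y) * f y ∂volume ∂Q := by
        rw [hQ, lintegral_map' (Measurable.lintegral_prod_right'
          (f := fun q => D q * f q.2) (by fun_prop)).aemeasurable hxw]
    _ = ∫⁻ y, ∫⁻ p, D (p, y) * f y ∂Q ∂volume := lintegral_lintegral_swap
        (Measurable.aemeasurable (f := fun q => D q * f q.2) (by fun_prop))
    _ = ∫⁻ y, f y ∂(volume.withDensity fun y => ENNReal.ofReal (M.likelihood T P x0 w θ y)) := by
        rw [lintegral_withDensity_eq_lintegral_mul _ hlm hf]
        refine lintegral_congr fun y => ?_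
        rw [lintegral_mul_const _ (by fun_prop), Pi.mul_apply, hlik]

end Model

end Noise

end


/-! ### Entrywise calculus for matrices and the sensitivity recursions. -/

noncomputable section

section Calculus

variable {ι : Type*} [Fintype ι] [DecidableEq ι] {θ : ι → ℝ}

/-- `f` is differentiable at `θ` with partial derivatives `g i`. -/
def HasGrad (f : (ι → ℝ) → ℝ) (g : ι → ℝ) (θ : ι → ℝ) : Prop :=
  DifferentiableAt ℝ f θ ∧ ∀ i, pderiv i f θ = g i

/-- The entrywise version of `HasGrad` for vectors. -/
def HasVecGrad {κ : Type*} (f : (ι → ℝ) → κ → ℝ) (g : ι → κ → ℝ) (θ : ι → ℝ) : Prop :=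
  ∀ k, HasGrad (fun θ' => f θ' k) (fun i => g i k) θ

/-- The entrywise version of `HasGrad` for matrices. -/
def HasMatGrad {m n : Type*} (f : (ι → ℝ) → Matrix m n ℝ) (g : ι → Matrix m n ℝ) (θ : ι → ℝ) :
    Prop :=
  ∀ r c, HasGrad (fun θ' => f θ' r c) (fun i => g i r c) θ

namespace HasGrad

variable {f f' : (ι → ℝ) → ℝ} {g g' : ι → ℝ}

theorem congr_grad (h : HasGrad f g θ) (hg : ∀ i, g i = g' i) : HasGrad f g' θ :=
  ⟨h.1, fun i => (h.2 i).trans (hg i)⟩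

theorem const (c : ℝ) : HasGrad (fun _ : ι → ℝ => c) (fun _ => 0) θ :=
  ⟨differentiableAt_const c, fun i => by simp [pderiv]⟩

theorem coord (j : ι) : HasGrad (fun θ' : ι → ℝ => θ' j) (fun i => if i = j then 1 else 0) θ := by
  refine ⟨by fun_prop, fun i => ?_⟩
  have : HasFDerivAt (fun θ' : ι → ℝ => θ' j) (ContinuousLinearMap.proj (R := ℝ) j) θ :=
    (ContinuousLinearMap.proj (R := ℝ) (φ := fun _ : ι => ℝ) j).hasFDerivAt
  simp [pderiv, this.fderiv, Pi.single_apply, eq_comm]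

theorem add (h : HasGrad f g θ) (h' : HasGrad f' g' θ) :
    HasGrad (fun θ' => f θ' + f' θ') (fun i => g i + g' i) θ :=
  ⟨h.1.add h'.1, fun i => by simp [← h.2, ← h'.2, pderiv, fderiv_fun_add h.1 h'.1]⟩

theorem neg (h : HasGrad f g θ) : HasGrad (fun θ' => -f θ') (fun i => -g i) θ :=
  ⟨h.1.neg, fun i => by simp [← h.2, pderiv, fderiv_fun_neg]⟩

theorem sub (h : HasGrad f g θ) (h' : HasGrad f' g' θ) :
    HasGrad (fun θ' => f θ' - f' θ') (fun i => g i - g' i) θ := by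
  simpa [sub_eq_add_neg] using h.add h'.neg

theorem mul (h : HasGrad f g θ) (h' : HasGrad f' g' θ) :
    HasGrad (fun θ' => f θ' * f' θ') (fun i => g i * f' θ + f θ * g' i) θ :=
  ⟨h.1.mul h'.1, fun i => by
    simp [← h.2, ← h'.2, pderiv, fderiv_fun_mul h.1 h'.1]; ring⟩

theorem const_mul (c : ℝ) (h : HasGrad f g θ) :
    HasGrad (fun θ' => c * f θ') (fun i => c * g i) θ :=
  ((const c).mul h).congr_grad fun i => by simp

theorem sum {κ : Type*} {s : Finset κ} {f : κ → (ι → ℝ) → ℝ} {g : κ → ι → ℝ}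
    (h : ∀ k ∈ s, HasGrad (f k) (g k) θ) :
    HasGrad (fun θ' => ∑ k ∈ s, f k θ') (fun i => ∑ k ∈ s, g k i) θ := by
  refine ⟨DifferentiableAt.fun_sum fun k hk => (h k hk).1, fun i => ?_⟩
  simp only [pderiv, fderiv_fun_sum fun k hk => (h k hk).1, _root_.sum_apply]
  exact Finset.sum_congr rfl fun k hk => (h k hk).2 i

theorem prod {κ : Type*} [DecidableEq κ] {s : Finset κ} {f : κ → (ι → ℝ) → ℝ} {g : κ → ι → ℝ}
    (h : ∀ k ∈ s, HasGrad (f k) (g k) θ) :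
    HasGrad (fun θ' => ∏ k ∈ s, f k θ')
      (fun i => ∑ k ∈ s, (∏ l ∈ s.erase k, f l θ) * g k i) θ := by
  have hd := HasFDerivAt.finsetProd (u := s) fun k hk => (h k hk).1.hasFDerivAt
  refine ⟨hd.differentiableAt, fun i => ?_⟩
  simp only [pderiv, hd.fderiv, _root_.sum_apply, _root_.smul_apply,
    smul_eq_mul]
  exact Finset.sum_congr rfl fun k hk => by rw [← (h k hk).2 i]; rfl

theorem log (h : HasGrad f g θ) (h0 : f θ ≠ 0) :
    HasGrad (fun θ' => Real.log (f θ')) (fun i => (f θ)⁻¹ * g i) θ := by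
  have hd := h.1.hasFDerivAt.log h0
  refine ⟨hd.differentiableAt, fun i => ?_⟩
  simp [pderiv, hd.fderiv, ← h.2 i]

end HasGrad

variable {l m n : Type*}

namespace HasMatGrad

variable {f f' : (ι → ℝ) → Matrix m n ℝ} {g g' : ι → Matrix m n ℝ}

theorem congr_grad (h : HasMatGrad f g θ) (hg : ∀ i, g i = g' i) : HasMatGrad f g' θ :=
  fun r c => (h r c).congr_grad fun i => by rw [hg]

theorem const (c : Matrix m n ℝ) : HasMatGrad (fun _ : ι → ℝ => c) (fun _ => 0) θ :=
  fun _ _ => HasGrad.const _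

theorem add (h : HasMatGrad f g θ) (h' : HasMatGrad f' g' θ) :
    HasMatGrad (fun θ' => f θ' + f' θ') (fun i => g i + g' i) θ :=
  fun r c => (h r c).add (h' r c)

theorem sub (h : HasMatGrad f g θ) (h' : HasMatGrad f' g' θ) :
    HasMatGrad (fun θ' => f θ' - f' θ') (fun i => g i - g' i) θ :=
  fun r c => (h r c).sub (h' r c)

theorem transpose (h : HasMatGrad f g θ) :
    HasMatGrad (fun θ' => (f θ')ᵀ) (fun i => (g i)ᵀ) θ :=
  fun r c => h c r

theorem mul [Fintype n] {q : (ι → ℝ) → Matrix n l ℝ} {k : ι → Matrix n l ℝ}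
    (h : HasMatGrad f g θ) (h' : HasMatGrad q k θ) :
    HasMatGrad (fun θ' => f θ' * q θ') (fun i => g i * q θ + f θ * k i) θ := fun r c =>
  (HasGrad.sum (s := Finset.univ) fun j _ => (h r j).mul (h' j c)).congr_grad fun i => by
    simp [Matrix.mul_apply, Finset.sum_add_distrib]

theorem mulVec [Fintype n] {v : (ι → ℝ) → n → ℝ} {dv : ι → n → ℝ}
    (h : HasMatGrad f g θ) (h' : HasVecGrad v dv θ) :
    HasVecGrad (fun θ' => f θ' *ᵥ v θ') (fun i => g i *ᵥ v θ + f θ *ᵥ dv i) θ := fun r =>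
  (HasGrad.sum (s := Finset.univ) fun j _ => (h r j).mul (h' j)).congr_grad fun i => by
    simp [Matrix.mulVec, dotProduct, Finset.sum_add_distrib]

theorem matDeriv_eq (h : HasMatGrad f g θ) (i : ι) : matDeriv i f θ = g i := by
  ext r c
  exact (h r c).2 i

variable [Fintype n] [DecidableEq n] {S : (ι → ℝ) → Matrix n n ℝ} {dS : ι → Matrix n n ℝ}

/-- Jacobi's formula. Differentiating the Leibniz expansion column by column gives determinants with
column `k` replaced by its derivative; by Cramer's rule these are the diagonal entries of `adj(S)
dS`. -/
theorem det (h : HasMatGrad S dS θ) :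
    HasGrad (fun θ' => (S θ').det) (fun i => ((S θ).adjugate * dS i).trace) θ := by
  have h1 : HasGrad (fun θ' => ∑ σ : Equiv.Perm n, ((Equiv.Perm.sign σ : ℤ) : ℝ) *
      ∏ j, S θ' (σ j) j) (fun i => ∑ σ : Equiv.Perm n, ((Equiv.Perm.sign σ : ℤ) : ℝ) *
        ∑ k, (∏ j ∈ Finset.univ.erase k, S θ (σ j) j) * dS i (σ k) k) θ :=
    HasGrad.sum fun σ _ => (HasGrad.prod fun j _ => h (σ j) j).const_mul _
  simp only [Matrix.det_apply']
  refine h1.congr_grad fun i => ?_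
  have h2 : ∀ k, ((S θ).adjugate * dS i) k k = ((S θ).updateCol k fun r => dS i r k).det := by
    intro k
    rw [← cramer_apply, cramer_eq_adjugate_mulVec]
    rfl
  simp only [Matrix.trace, Matrix.diag, h2, Matrix.det_apply', Finset.mul_sum]
  rw [Finset.sum_comm]
  refine Finset.sum_congr rfl fun k _ => Finset.sum_congr rfl fun σ _ => ?_
  rw [← Finset.mul_prod_erase Finset.univ _ (Finset.mem_univ k), updateCol_self, mul_comm (dS i _ _)]
  congr 2
  refine Finset.prod_congr rfl fun j hj => ?_
  rw [updateCol_ne (Finset.ne_of_mem_erase hj)]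

/-- An entry of the adjugate is the determinant of `S` with one row replaced by a constant basis
vector, so the previous formula also covers the inverse. -/
theorem differentiableAt_inv (h : HasMatGrad S dS θ) (hu : IsUnit (S θ).det) (r c : n) :
    DifferentiableAt ℝ (fun θ' => (S θ')⁻¹ r c) θ := by
  have h1 : HasMatGrad (fun θ' => (S θ').updateRow c (Pi.single r 1))
      (fun i => (dS i).updateRow c 0) θ := by
    intro a b
    by_cases hac : a = c
    · subst hac
      simpa using HasGrad.const _
    · simpa [updateRow_ne hac] using h a b
  simp only [Matrix.inv_def, Matrix.smul_apply, adjugate_apply, Ring.inverse_eq_inv',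
    smul_eq_mul]
  exact (h.det.1.inv hu.ne_zero).mul h1.det.1

/-- Once differentiability is known, the derivative is solved for from `S S⁻¹ = 1`. Invertibility is
asked at every `θ'` so that this product is constant as a function. -/
theorem inv (h : HasMatGrad S dS θ) (hu : ∀ θ', IsUnit (S θ').det) :
    HasMatGrad (fun θ' => (S θ')⁻¹) (fun i => -((S θ)⁻¹ * dS i * (S θ)⁻¹)) θ := by
  have h1 : HasMatGrad (fun θ' => (S θ')⁻¹) (fun i => matDeriv i (fun θ' => (S θ')⁻¹) θ) θ :=
    fun r c => ⟨h.differentiableAt_inv (hu θ) r c, fun _ => rfl⟩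
  refine h1.congr_grad fun i => ?_
  have h2 := (h.mul h1).matDeriv_eq i
  simp only [fun θ' => Matrix.mul_nonsing_inv _ (hu θ')] at h2
  rw [(HasMatGrad.const (1 : Matrix n n ℝ)).matDeriv_eq i] at h2
  have h3 := congrArg (fun X => (S θ)⁻¹ * X) h2
  simp only [Matrix.mul_zero, Matrix.mul_add, Matrix.nonsing_inv_mul_cancel_left _ _ (hu θ)] at h3
  rw [Matrix.mul_assoc]
  exact eq_neg_of_add_eq_zero_right h3.symm

theorem log_det (h : HasMatGrad S dS θ) (hu : IsUnit (S θ).det) :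
    HasGrad (fun θ' => Real.log (S θ').det) (fun i => ((S θ)⁻¹ * dS i).trace) θ :=
  (h.det.log hu.ne_zero).congr_grad fun i => by
    rw [Matrix.inv_def, Ring.inverse_eq_inv', Matrix.smul_mul, trace_smul, smul_eq_mul]

end HasMatGrad

namespace HasVecGrad

variable {f f' : (ι → ℝ) → n → ℝ} {g g' : ι → n → ℝ}

theorem congr_grad (h : HasVecGrad f g θ) (hg : ∀ i, g i = g' i) : HasVecGrad f g' θ :=
  fun r => (h r).congr_grad fun i => by rw [hg]

theorem const (c : n → ℝ) : HasVecGrad (fun _ : ι → ℝ => c) (fun _ => 0) θ :=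
  fun _ => HasGrad.const _

theorem add (h : HasVecGrad f g θ) (h' : HasVecGrad f' g' θ) :
    HasVecGrad (fun θ' => f θ' + f' θ') (fun i => g i + g' i) θ :=
  fun r => (h r).add (h' r)

theorem sub (h : HasVecGrad f g θ) (h' : HasVecGrad f' g' θ) :
    HasVecGrad (fun θ' => f θ' - f' θ') (fun i => g i - g' i) θ :=
  fun r => (h r).sub (h' r)

theorem dotProduct [Fintype n] (h : HasVecGrad f g θ) (h' : HasVecGrad f' g' θ) :
    HasGrad (fun θ' => f θ' ⬝ᵥ f' θ') (fun i => g i ⬝ᵥ f' θ + f θ ⬝ᵥ g' i) θ :=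
  (HasGrad.sum (s := Finset.univ) fun j _ => (h j).mul (h' j)).congr_grad fun i => by
    simp [_root_.dotProduct, Finset.sum_add_distrib]

theorem differentiableAt [Fintype n] (h : HasVecGrad f g θ) : DifferentiableAt ℝ f θ :=
  differentiableAt_pi.mpr fun k => (h k).1

theorem jacobian_apply (h : HasVecGrad f g θ) (k : n) (i : ι) : jacobian f θ k i = g i k :=
  (h k).2 i

end HasVecGrad

/-- The partial derivatives of an entry of a structured matrix. -/
def Entry.grad (i : ι) : Entry ι → ℝ
  | .fixed _ => 0
  | .pos j => if i = j then 1 else 0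
  | .neg j => -(if i = j then 1 else 0)

theorem Entry.hasGrad_eval (a : Entry ι) :
    HasGrad (fun θ' => a.eval θ') (fun i => a.grad i) θ := by
  cases a with
  | fixed c => exact HasGrad.const c
  | pos j => exact HasGrad.coord j
  | neg j => exact (HasGrad.coord j).neg

theorem hasMatGrad_map_eval (E : Matrix m n (Entry ι)) :
    HasMatGrad (fun θ' => E.map (Entry.eval θ'))
      (fun i => matDeriv i (fun θ' => E.map (Entry.eval θ')) θ) θ :=
  fun r c => ⟨(Entry.hasGrad_eval (E r c)).1, fun _ => rfl⟩

end Calculus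

variable {ι : Type*} [Fintype ι] [DecidableEq ι] {dx du dy : ℕ}

namespace Model

variable {M : Model ι dx du dy} {θ : ι → ℝ}

theorem hasMatGrad_A : HasMatGrad M.A (fun i => matDeriv i M.A θ) θ := hasMatGrad_map_eval M.entryA

theorem hasMatGrad_B : HasMatGrad M.B (fun i => matDeriv i M.B θ) θ := hasMatGrad_map_eval M.entryB

theorem hasMatGrad_C : HasMatGrad M.C (fun i => matDeriv i M.C θ) θ := hasMatGrad_map_eval M.entryC

theorem hasMatGrad_predictCov {Q : (ι → ℝ) → Matrix (Fin dx) (Fin dx) ℝ}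
    {dQ : ι → Matrix (Fin dx) (Fin dx) ℝ} (h : HasMatGrad Q dQ θ) :
    HasMatGrad (fun θ' => M.predictCov θ' (Q θ')) (fun i => M.dPredictCov θ i (Q θ) (dQ i)) θ :=
  (((hasMatGrad_A.mul h).mul hasMatGrad_A.transpose).add (.const M.procCov)).congr_grad fun i => by
    simp [dPredictCov, Matrix.add_mul]

theorem hasMatGrad_residualCov {Q : (ι → ℝ) → Matrix (Fin dx) (Fin dx) ℝ}
    {dQ : ι → Matrix (Fin dx) (Fin dx) ℝ} (h : HasMatGrad Q dQ θ) :
    HasMatGrad (fun θ' => M.residualCov θ' (Q θ')) (fun i => M.dResidualCov θ i (Q θ) (dQ i)) θ :=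
  (((hasMatGrad_C.mul h).mul hasMatGrad_C.transpose).add (.const M.measCov)).congr_grad fun i => by
    simp [dResidualCov, Matrix.add_mul]

theorem hasMatGrad_gainOf {Q : (ι → ℝ) → Matrix (Fin dx) (Fin dx) ℝ}
    {dQ : ι → Matrix (Fin dx) (Fin dx) ℝ} (h : HasMatGrad Q dQ θ)
    (hu : ∀ θ', IsUnit (M.residualCov θ' (Q θ')).det) :
    HasMatGrad (fun θ' => M.gainOf θ' (Q θ')) (fun i => M.dGainOf θ i (Q θ) (dQ i)) θ :=
  ((h.mul hasMatGrad_C.transpose).mul ((hasMatGrad_residualCov h).inv hu)).congr_grad fun i => by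
    simp [dGainOf, Matrix.add_mul, sub_eq_add_neg]

/-- The gain contains `S⁻¹`; positive definiteness of `S` at every parameter value supplies the
required invertibility. -/
theorem hasMatGrad_filtCov (h0 : M.initCov.PosSemidef) (hw : M.procCov.PosSemidef)
    (hz : M.measCov.PosDef) (t : ℕ) :
    HasMatGrad (fun θ' => M.filtCov θ' t) (fun i => M.dFiltCov θ i t) θ := by
  induction t with
  | zero => exact HasMatGrad.const _
  | succ t ih =>
    have h1 := hasMatGrad_predictCov (M := M) ih
    have h2 := hasMatGrad_gainOf h1 fun θ' => posDef_isUnit_det (posDef_innovCov h0 hw hz θ' t)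
    exact (h1.sub ((h2.mul hasMatGrad_C).mul h1)).congr_grad fun i => by
      simp only [dFiltCov, Matrix.add_mul]
      rfl

theorem hasMatGrad_predCov (h0 : M.initCov.PosSemidef) (hw : M.procCov.PosSemidef)
    (hz : M.measCov.PosDef) (t : ℕ) :
    HasMatGrad (fun θ' => M.predCov θ' t) (fun i => M.dPredCov θ i t) θ :=
  hasMatGrad_predictCov (hasMatGrad_filtCov h0 hw hz t)

theorem hasMatGrad_innovCov (h0 : M.initCov.PosSemidef) (hw : M.procCov.PosSemidef)
    (hz : M.measCov.PosDef) (t : ℕ) :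
    HasMatGrad (fun θ' => M.innovCov θ' t) (fun i => M.dInnovCov θ i t) θ :=
  hasMatGrad_residualCov (hasMatGrad_predCov h0 hw hz t)

theorem hasMatGrad_gain (h0 : M.initCov.PosSemidef) (hw : M.procCov.PosSemidef)
    (hz : M.measCov.PosDef) (t : ℕ) :
    HasMatGrad (fun θ' => M.gain θ' t) (fun i => M.dGain θ i t) θ :=
  hasMatGrad_gainOf (hasMatGrad_predCov h0 hw hz t) fun θ' =>
    posDef_isUnit_det (posDef_innovCov h0 hw hz θ' t)

theorem hasVecGrad_filtMean (h0 : M.initCov.PosSemidef) (hw : M.procCov.PosSemidef)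
    (hz : M.measCov.PosDef) {T : ℕ} (y : Fin T → Fin dy → ℝ) (t : ℕ) :
    HasVecGrad (fun θ' => M.filtMean θ' y t) (fun i => M.dFiltMean θ y i t) θ := by
  induction t with
  | zero => exact HasVecGrad.const _
  | succ t ih =>
    have h1 := ((hasMatGrad_A (M := M)).mulVec ih).add
      ((hasMatGrad_B (M := M)).mulVec (.const (M.input t)))
    have h2 := (HasVecGrad.const (obs y t)).sub ((hasMatGrad_C (M := M)).mulVec h1)
    refine (h1.add ((hasMatGrad_gain h0 hw hz t).mulVec h2)).congr_grad fun i => ?_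
    simp only [dFiltMean, mulVec_zero, add_zero, zero_sub, innov, predMean, neg_add,
      neg_add_eq_sub, add_assoc]

theorem hasVecGrad_predMean (h0 : M.initCov.PosSemidef) (hw : M.procCov.PosSemidef)
    (hz : M.measCov.PosDef) {T : ℕ} (y : Fin T → Fin dy → ℝ) (t : ℕ) :
    HasVecGrad (fun θ' => M.predMean θ' y t) (fun i => M.dPredMean θ y i t) θ :=
  ((hasMatGrad_A.mulVec (hasVecGrad_filtMean h0 hw hz y t)).add
    (hasMatGrad_B.mulVec (.const (M.input t)))).congr_grad fun i => by
      simp [dPredMean]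

theorem hasVecGrad_innov (h0 : M.initCov.PosSemidef) (hw : M.procCov.PosSemidef)
    (hz : M.measCov.PosDef) {T : ℕ} (y : Fin T → Fin dy → ℝ) (t : ℕ) :
    HasVecGrad (fun θ' => M.innov θ' y t) (fun i => M.dInnov θ y i t) θ :=
  ((HasVecGrad.const (obs y t)).sub
    (hasMatGrad_C.mulVec (hasVecGrad_predMean h0 hw hz y t))).congr_grad fun i => by
      simp only [dInnov, zero_sub, neg_add]
      rw [sub_eq_add_neg, add_comm]

end Model

end


/-! ### Second and fourth moments of Gaussian vectors. -/

noncomputable section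

section RealMoments

open scoped NNReal

/-- Functions `p(t) exp(v t² / 2)` are stable under differentiation, so iterated derivatives of the
Gaussian moment generating function reduce to derivatives of polynomials. -/
theorem hasDerivAt_mul_exp_sq (v : ℝ) {p : ℝ → ℝ} {p' t : ℝ} (hp : HasDerivAt p p' t) :
    HasDerivAt (fun s => p s * Real.exp (v * s ^ 2 / 2))
      ((p' + v * t * p t) * Real.exp (v * t ^ 2 / 2)) t := by
  have h1 : HasDerivAt (fun s : ℝ => v * s ^ 2 / 2) (v * t) t := by
    have := (((hasDerivAt_id t).pow 2).const_mul v).div_const 2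
    convert! this using 1
    simp
    ring
  convert! hp.mul h1.exp using 1
  ring

theorem integral_pow_four_gaussianReal (v : ℝ≥0) :
    ∫ x, x ^ 4 ∂gaussianReal 0 v = 3 * (v : ℝ) ^ 2 := by
  have h := iteratedDeriv_mgf_zero (X := id) (μ := gaussianReal 0 v) (by simp) 4
  rw [mgf_id_gaussianReal] at h
  have e0 : (fun t : ℝ => Real.exp (0 * t + v * t ^ 2 / 2))
      = fun t => (fun _ => (1 : ℝ)) t * Real.exp (v * t ^ 2 / 2) := by
    funext t; simp
  have hd : ∀ (p p' : ℝ → ℝ), (∀ t, HasDerivAt p (p' t) t) →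
      deriv (fun s => p s * Real.exp (v * s ^ 2 / 2))
        = fun t => (p' t + v * t * p t) * Real.exp (v * t ^ 2 / 2) := fun p p' hp =>
    funext fun t => (hasDerivAt_mul_exp_sq (v : ℝ) (hp t)).deriv
  have hpow : ∀ (n : ℕ) (t : ℝ), HasDerivAt (fun s : ℝ => s ^ n) (n * t ^ (n - 1)) t :=
    fun n t => hasDerivAt_pow n t
  have e1 : deriv (fun t : ℝ => Real.exp (0 * t + v * t ^ 2 / 2))
      = fun t => (v * t) * Real.exp (v * t ^ 2 / 2) := by
    rw [e0, hd _ (fun _ => 0) fun t => hasDerivAt_const t 1]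
    funext t; ring
  have e2 : deriv (fun t : ℝ => (v * t) * Real.exp (v * t ^ 2 / 2))
      = fun t => (v + v ^ 2 * t ^ 2) * Real.exp (v * t ^ 2 / 2) := by
    rw [hd _ (fun _ => v) fun t => by simpa using (hasDerivAt_id t).const_mul (v : ℝ)]
    funext t; ring
  have e3 : deriv (fun t : ℝ => (v + v ^ 2 * t ^ 2) * Real.exp (v * t ^ 2 / 2))
      = fun t => (3 * v ^ 2 * t + v ^ 3 * t ^ 3) * Real.exp (v * t ^ 2 / 2) := by
    rw [hd _ (fun t => v ^ 2 * (2 * t)) fun t => by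
      simpa using ((hpow 2 t).const_mul ((v : ℝ) ^ 2)).const_add (v : ℝ)]
    funext t; ring
  have e4 : deriv (fun t : ℝ => (3 * v ^ 2 * t + v ^ 3 * t ^ 3) * Real.exp (v * t ^ 2 / 2))
      = fun t => (3 * v ^ 2 + 6 * v ^ 3 * t ^ 2 + v ^ 4 * t ^ 4)
        * Real.exp (v * t ^ 2 / 2) := by
    rw [hd _ (fun t => 3 * v ^ 2 + v ^ 3 * (3 * t ^ 2)) fun t => by
      simpa using ((hasDerivAt_id t).const_mul (3 * (v : ℝ) ^ 2)).fun_add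
        ((hpow 3 t).const_mul ((v : ℝ) ^ 3))]
    funext t; ring
  simp only [iteratedDeriv_succ', iteratedDeriv_zero, e1, e2, e3, e4] at h
  simpa using h.symm

end RealMoments

section VectorMoments

variable {d : ℕ} {S : Matrix (Fin d) (Fin d) ℝ}

theorem map_dotProduct_gaussVec (hS : S.PosSemidef) (a : Fin d → ℝ) :
    (gaussVec 0 S).map (fun x => a ⬝ᵥ x) = gaussianReal 0 (a ⬝ᵥ (S *ᵥ a)).toNNReal := by
  have hm := measurable_dotProduct_left a
  have := Measure.isProbabilityMeasure_map (μ := gaussVec 0 S) hm.aemeasurable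
  have hq : 0 ≤ a ⬝ᵥ (S *ᵥ a) := by simpa using hS.dotProduct_mulVec_nonneg a
  refine Measure.ext_of_charFun (funext fun t => ?_)
  rw [charFun_apply_real, integral_map hm.aemeasurable (by fun_prop), charFun_gaussianReal]
  have h := integral_cexp_gaussVec 0 hS (t • a)
  have e : ∀ x : Fin d → ℝ, ((t • a ⬝ᵥ x : ℝ) : ℂ) = (t : ℂ) * ((a ⬝ᵥ x : ℝ) : ℂ) := by
    intro x
    rw [smul_dotProduct, smul_eq_mul, Complex.ofReal_mul]
  simp_rw [e] at h
  rw [h, mulVec_smul, dotProduct_smul]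
  simp only [dotProduct_zero, smul_eq_mul, Real.coe_toNNReal _ hq]
  push_cast
  congr 1
  ring

theorem memLp_id_gaussVec (m : Fin d → ℝ) (S : Matrix (Fin d) (Fin d) ℝ) {p : ENNReal}
    (hp : p ≠ ⊤) : MemLp (fun x => x) p (gaussVec m S) :=
  IsGaussian.memLp_id (gaussVec m S) p hp

theorem memLp_coord_gaussVec (m : Fin d → ℝ) (S : Matrix (Fin d) (Fin d) ℝ) {p : ENNReal}
    (hp : p ≠ ⊤) (a : Fin d) : MemLp (fun x => x a) p (gaussVec m S) :=
  (ContinuousLinearMap.proj (R := ℝ) (φ := fun _ : Fin d => ℝ) a).comp_memLp'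
    (memLp_id_gaussVec m S hp)

theorem memLp_dotProduct_gaussVec (m : Fin d → ℝ) (S : Matrix (Fin d) (Fin d) ℝ) {p : ENNReal}
    (hp : p ≠ ⊤) (a : Fin d → ℝ) : MemLp (fun x => a ⬝ᵥ x) p (gaussVec m S) :=
  memLp_finsetSum _ fun i _ => (memLp_coord_gaussVec m S hp i).const_mul (a i)

theorem holderTriple_four_four_two : ENNReal.HolderTriple 4 4 2 := by
  refine ⟨?_⟩
  rw [← two_mul, show (4 : ENNReal) = 2 * 2 by norm_num, ENNReal.mul_inv (by simp) (by simp),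
    ← mul_assoc, ENNReal.mul_inv_cancel (by simp) (by simp), one_mul]

theorem memLp_coord_mul_coord_gaussVec (m : Fin d → ℝ) (S : Matrix (Fin d) (Fin d) ℝ)
    (a b : Fin d) : MemLp (fun x => x a * x b) 2 (gaussVec m S) := by
  have := holderTriple_four_four_two
  exact (memLp_coord_gaussVec m S (p := 4) (by simp) b).mul'
    (memLp_coord_gaussVec m S (p := 4) (by simp) a)

theorem integrable_coord_pow_four (m : Fin d → ℝ) (S : Matrix (Fin d) (Fin d) ℝ)
    (a b c e : Fin d) : Integrable (fun x => x a * x b * (x c * x e)) (gaussVec m S) :=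
  (memLp_coord_mul_coord_gaussVec m S a b).integrable_mul (memLp_coord_mul_coord_gaussVec m S c e)

theorem integral_dotProduct_pow_two (hS : S.PosSemidef) (a : Fin d → ℝ) :
    ∫ x, (a ⬝ᵥ x) ^ 2 ∂gaussVec 0 S = a ⬝ᵥ (S *ᵥ a) := by
  have hq : 0 ≤ a ⬝ᵥ (S *ᵥ a) := by simpa using hS.dotProduct_mulVec_nonneg a
  have h := integral_map (μ := gaussVec 0 S) (measurable_dotProduct_left a).aemeasurable
    (f := fun x : ℝ => x ^ 2) (by fun_prop)
  rw [← h, map_dotProduct_gaussVec hS]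
  have h2 := variance_fun_id_gaussianReal (μ := 0) (v := (a ⬝ᵥ (S *ᵥ a)).toNNReal)
  rw [variance_of_integral_eq_zero (by fun_prop) (by simp)] at h2
  rw [h2, Real.coe_toNNReal _ hq]

theorem integral_dotProduct_pow_four (hS : S.PosSemidef) (a : Fin d → ℝ) :
    ∫ x, (a ⬝ᵥ x) ^ 4 ∂gaussVec 0 S = 3 * (a ⬝ᵥ (S *ᵥ a)) ^ 2 := by
  have hq : 0 ≤ a ⬝ᵥ (S *ᵥ a) := by simpa using hS.dotProduct_mulVec_nonneg a
  have h := integral_map (μ := gaussVec 0 S) (measurable_dotProduct_left a).aemeasurable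
    (f := fun x : ℝ => x ^ 4) (by fun_prop)
  rw [← h, map_dotProduct_gaussVec hS, integral_pow_four_gaussianReal, Real.coe_toNNReal _ hq]

theorem integrable_dotProduct_pow (m : Fin d → ℝ) (S : Matrix (Fin d) (Fin d) ℝ) (a : Fin d → ℝ)
    (n : ℕ) : Integrable (fun x => (a ⬝ᵥ x) ^ n) (gaussVec m S) := by
  have h := memLp_dotProduct_gaussVec m S (p := n) (by simp) a
  rcases Nat.eq_zero_or_pos n with rfl | hn
  · simp
  · refine (h.integrable_norm_pow hn.ne').mono' ?_ (ae_of_all _ fun x => by simp)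
    exact (measurable_dotProduct_left a).pow_const n |>.aestronglyMeasurable

theorem posSemidef_symm (hS : S.PosSemidef) (a b : Fin d → ℝ) :
    a ⬝ᵥ (S *ᵥ b) = b ⬝ᵥ (S *ᵥ a) := by
  have h : Sᵀ = S := by simpa [Matrix.IsHermitian] using hS.isHermitian
  rw [dotProduct_mulVec, ← mulVec_transpose, h, dotProduct_comm]

theorem integral_dotProduct_mul (hS : S.PosSemidef) (a b : Fin d → ℝ) :
    ∫ x, (a ⬝ᵥ x) * (b ⬝ᵥ x) ∂gaussVec 0 S = a ⬝ᵥ (S *ᵥ b) := by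
  have e : ∀ x : Fin d → ℝ, (a ⬝ᵥ x) * (b ⬝ᵥ x)
      = (1 / 4) * (((a + b) ⬝ᵥ x) ^ 2 - ((a - b) ⬝ᵥ x) ^ 2) := by
    intro x
    rw [add_dotProduct, sub_dotProduct]
    ring
  simp_rw [e]
  rw [integral_const_mul, integral_sub (integrable_dotProduct_pow _ _ _ _)
    (integrable_dotProduct_pow _ _ _ _), integral_dotProduct_pow_two hS,
    integral_dotProduct_pow_two hS]
  simp only [mulVec_add, mulVec_sub, add_dotProduct, sub_dotProduct, dotProduct_add,
    dotProduct_sub, posSemidef_symm hS b a]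
  ring

/-- Isserlis' formula by polarization from the fourth moment `3 (aᵀ S a)²` of one linear form. -/
theorem integral_dotProduct_mul_four (hS : S.PosSemidef) (a b c e : Fin d → ℝ) :
    ∫ x, (a ⬝ᵥ x) * (b ⬝ᵥ x) * ((c ⬝ᵥ x) * (e ⬝ᵥ x)) ∂gaussVec 0 S
      = (a ⬝ᵥ (S *ᵥ b)) * (c ⬝ᵥ (S *ᵥ e)) + (a ⬝ᵥ (S *ᵥ c)) * (b ⬝ᵥ (S *ᵥ e))
        + (a ⬝ᵥ (S *ᵥ e)) * (b ⬝ᵥ (S *ᵥ c)) := by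
  -- Eight sign patterns with the sign of `a` fixed. Only the mixed monomial survives, with
  -- coefficient `4!` in each, whence `192 = 8 · 24`.
  have key : ∀ x : Fin d → ℝ, (a ⬝ᵥ x) * (b ⬝ᵥ x) * ((c ⬝ᵥ x) * (e ⬝ᵥ x)) = (1 / 192) *
      ((((a + b + c + e) ⬝ᵥ x) ^ 4 + ((a + b - c - e) ⬝ᵥ x) ^ 4
        + (((a - b + c - e) ⬝ᵥ x) ^ 4 + ((a - b - c + e) ⬝ᵥ x) ^ 4))
      - (((a + b + c - e) ⬝ᵥ x) ^ 4 + ((a + b - c + e) ⬝ᵥ x) ^ 4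
        + (((a - b + c + e) ⬝ᵥ x) ^ 4 + ((a - b - c - e) ⬝ᵥ x) ^ 4))) := by
    intro x
    simp only [add_dotProduct, sub_dotProduct]
    ring
  have hi := fun a => integrable_dotProduct_pow (0 : Fin d → ℝ) S a 4
  have h2i : ∀ p q, Integrable (fun x => (p ⬝ᵥ x) ^ 4 + (q ⬝ᵥ x) ^ 4) (gaussVec 0 S) :=
    fun p q => (hi p).add (hi q)
  have h4i : ∀ p q r s, Integrable (fun x => (p ⬝ᵥ x) ^ 4 + (q ⬝ᵥ x) ^ 4
      + ((r ⬝ᵥ x) ^ 4 + (s ⬝ᵥ x) ^ 4)) (gaussVec 0 S) :=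
    fun p q r s => (h2i p q).add (h2i r s)
  simp_rw [key]
  rw [integral_const_mul, integral_sub (h4i _ _ _ _) (h4i _ _ _ _), integral_add (h2i _ _)
    (h2i _ _), integral_add (h2i _ _) (h2i _ _), integral_add (hi _) (hi _),
    integral_add (hi _) (hi _), integral_add (hi _) (hi _), integral_add (hi _) (hi _)]
  rw [integral_dotProduct_pow_four hS, integral_dotProduct_pow_four hS,
    integral_dotProduct_pow_four hS, integral_dotProduct_pow_four hS,
    integral_dotProduct_pow_four hS, integral_dotProduct_pow_four hS,
    integral_dotProduct_pow_four hS, integral_dotProduct_pow_four hS]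
  simp only [mulVec_add, mulVec_sub, add_dotProduct,
    sub_dotProduct, dotProduct_add, dotProduct_sub, posSemidef_symm hS b a,
    posSemidef_symm hS c a, posSemidef_symm hS e a, posSemidef_symm hS c b,
    posSemidef_symm hS e b, posSemidef_symm hS e c]
  ring

theorem integral_coord_mul_coord (hS : S.PosSemidef) (a b : Fin d) :
    ∫ x, x a * x b ∂gaussVec 0 S = S a b := by
  simpa using integral_dotProduct_mul hS (Pi.single a 1) (Pi.single b 1)

theorem integral_coord_mul_four (hS : S.PosSemidef) (a b c e : Fin d) :
    ∫ x, x a * x b * (x c * x e) ∂gaussVec 0 S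
      = S a b * S c e + S a c * S b e + S a e * S b c := by
  simpa using integral_dotProduct_mul_four hS (Pi.single a 1) (Pi.single b 1) (Pi.single c 1)
    (Pi.single e 1)

/-- The centred law is invariant under `x ↦ -x`. No integrability is needed, since the change of
variables is a measurable equivalence. -/
theorem integral_odd_gaussVec (hS : S.PosSemidef) {f : (Fin d → ℝ) → ℝ} (hf : ∀ x, f (-x) = -f x) :
    ∫ x, f x ∂gaussVec 0 S = 0 := by
  have h := map_affine_gaussVec (0 : Fin d → ℝ) hS 0 (-1 : Matrix (Fin d) (Fin d) ℝ)
  simp only [neg_mulVec, one_mulVec, zero_add, neg_zero, Matrix.neg_mul, Matrix.one_mul,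
    Matrix.transpose_neg, transpose_one, Matrix.mul_neg, Matrix.mul_one, neg_neg] at h
  have h2 : ∫ x, f x ∂gaussVec 0 S = ∫ x, f (-x) ∂gaussVec 0 S := by
    conv_lhs => rw [← h]
    exact (MeasurableEquiv.neg (Fin d → ℝ)).measurableEmbedding.integral_map f
  simp_rw [hf, integral_neg] at h2
  linarith

theorem dotProduct_mulVec_eq_sum (W : Matrix (Fin d) (Fin d) ℝ) (x : Fin d → ℝ) :
    x ⬝ᵥ (W *ᵥ x) = ∑ a, ∑ b, W a b * (x a * x b) := by
  simp only [dotProduct, mulVec, Finset.mul_sum]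
  refine Finset.sum_congr rfl fun a _ => Finset.sum_congr rfl fun b _ => ?_
  ring

theorem memLp_quadratic_gaussVec (m : Fin d → ℝ) (S W : Matrix (Fin d) (Fin d) ℝ) :
    MemLp (fun x => x ⬝ᵥ (W *ᵥ x)) 2 (gaussVec m S) := by
  simp_rw [dotProduct_mulVec_eq_sum]
  exact memLp_finsetSum _ fun a _ => memLp_finsetSum _ fun b _ =>
    (memLp_coord_mul_coord_gaussVec m S a b).const_mul _

theorem integral_quadratic_gaussVec (hS : S.PosSemidef) (W : Matrix (Fin d) (Fin d) ℝ) :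
    ∫ x, x ⬝ᵥ (W *ᵥ x) ∂gaussVec 0 S = (W * S).trace := by
  have hi := fun a b => ((memLp_coord_mul_coord_gaussVec 0 S a b).integrable one_le_two).const_mul
    (W a b)
  have hsym : ∀ a b, S a b = S b a := fun a b => by
    simpa using posSemidef_symm hS (Pi.single a 1) (Pi.single b 1)
  simp_rw [dotProduct_mulVec_eq_sum]
  rw [integral_finsetSum _ fun a _ => integrable_finsetSum _ fun b _ => hi a b]
  simp only [Matrix.trace, Matrix.diag, Matrix.mul_apply]
  refine Finset.sum_congr rfl fun a _ => ?_
  rw [integral_finsetSum _ fun b _ => hi a b]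
  refine Finset.sum_congr rfl fun b _ => ?_
  rw [integral_const_mul, integral_coord_mul_coord hS, hsym]

theorem trace_mul_four (W V : Matrix (Fin d) (Fin d) ℝ) (S R : Matrix (Fin d) (Fin d) ℝ) :
    (W * S * V * R).trace = ∑ a, ∑ b, ∑ c, ∑ e, W a b * V c e * (S b c * R e a) := by
  simp only [Matrix.trace, Matrix.diag, Matrix.mul_apply, Finset.sum_mul]
  refine Finset.sum_congr rfl fun a _ => ?_
  have h : ∀ e, ∑ c, ∑ b, W a b * S b c * V c e * R e a
      = ∑ b, ∑ c, W a b * V c e * (S b c * R e a) := by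
    intro e
    rw [Finset.sum_comm]
    refine Finset.sum_congr rfl fun b _ => Finset.sum_congr rfl fun c _ => ?_
    ring
  simp_rw [h]
  rw [Finset.sum_comm]
  refine Finset.sum_congr rfl fun b _ => ?_
  rw [Finset.sum_comm]

/-- Of the three Isserlis pairings, the one inside each form gives the product of traces; the two
crossed ones each give `tr(W S V S)`. -/
theorem integral_quadratic_mul_quadratic (hS : S.PosSemidef) (W V : Matrix (Fin d) (Fin d) ℝ)
    (hV : Vᵀ = V) :
    ∫ x, (x ⬝ᵥ (W *ᵥ x)) * (x ⬝ᵥ (V *ᵥ x)) ∂gaussVec 0 S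
      = (W * S).trace * (V * S).trace + 2 * (W * S * V * S).trace := by
  have hsym : ∀ a b, S a b = S b a := fun a b => by
    simpa using posSemidef_symm hS (Pi.single a 1) (Pi.single b 1)
  have hVs : ∀ a b, V a b = V b a := fun a b => congrFun (congrFun hV.symm a) b
  have e : ∀ x : Fin d → ℝ, (x ⬝ᵥ (W *ᵥ x)) * (x ⬝ᵥ (V *ᵥ x))
      = ∑ a, ∑ b, ∑ c, ∑ e, W a b * V c e * (x a * x b * (x c * x e)) := by
    intro x
    rw [dotProduct_mulVec_eq_sum, dotProduct_mulVec_eq_sum]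
    simp only [Finset.sum_mul]
    refine Finset.sum_congr rfl fun a _ => Finset.sum_congr rfl fun b _ => ?_
    simp only [Finset.mul_sum]
    refine Finset.sum_congr rfl fun c _ => Finset.sum_congr rfl fun e _ => ?_
    ring
  have hi := fun a b c e => (integrable_coord_pow_four 0 S a b c e).const_mul (W a b * V c e)
  have h1 : ∫ x, (x ⬝ᵥ (W *ᵥ x)) * (x ⬝ᵥ (V *ᵥ x)) ∂gaussVec 0 S
      = ∑ a, ∑ b, ∑ c, ∑ e, W a b * V c e
        * (S a b * S c e + S a c * S b e + S a e * S b c) := by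
    simp_rw [e]
    rw [integral_finsetSum _ fun a _ => integrable_finsetSum _ fun b _ =>
      integrable_finsetSum _ fun c _ => integrable_finsetSum _ fun e _ => hi a b c e]
    refine Finset.sum_congr rfl fun a _ => ?_
    rw [integral_finsetSum _ fun b _ =>
      integrable_finsetSum _ fun c _ => integrable_finsetSum _ fun e _ => hi a b c e]
    refine Finset.sum_congr rfl fun b _ => ?_
    rw [integral_finsetSum _ fun c _ => integrable_finsetSum _ fun e _ => hi a b c e]
    refine Finset.sum_congr rfl fun c _ => ?_
    rw [integral_finsetSum _ fun e _ => hi a b c e]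
    refine Finset.sum_congr rfl fun e _ => ?_
    rw [integral_const_mul, integral_coord_mul_four hS]
  have h2 : (W * S).trace * (V * S).trace
      = ∑ a, ∑ b, ∑ c, ∑ e, W a b * V c e * (S a b * S c e) := by
    simp only [Matrix.trace, Matrix.diag, Matrix.mul_apply, Finset.sum_mul]
    refine Finset.sum_congr rfl fun a _ => Finset.sum_congr rfl fun b _ => ?_
    simp only [Finset.mul_sum]
    refine Finset.sum_congr rfl fun c _ => Finset.sum_congr rfl fun e _ => ?_
    rw [hsym b a, hsym e c]
    ring
  have h3 : (W * S * V * S).trace = ∑ a, ∑ b, ∑ c, ∑ e, W a b * V c e * (S a e * S b c) := by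
    rw [trace_mul_four]
    refine Finset.sum_congr rfl fun a _ => Finset.sum_congr rfl fun b _ =>
      Finset.sum_congr rfl fun c _ => Finset.sum_congr rfl fun e _ => ?_
    rw [hsym e a, mul_comm (S b c)]
  -- The second crossed pairing becomes the first after exchanging `c` and `e`; here the symmetry of
  -- `V` is used.
  have h4 : (W * S * V * S).trace = ∑ a, ∑ b, ∑ c, ∑ e, W a b * V c e * (S a c * S b e) := by
    rw [h3]
    refine Finset.sum_congr rfl fun a _ => Finset.sum_congr rfl fun b _ => ?_
    rw [Finset.sum_comm]
    refine Finset.sum_congr rfl fun c _ => Finset.sum_congr rfl fun e _ => ?_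
    rw [hVs e c]
  rw [h1, h2, two_mul]
  nth_rewrite 1 [h4]
  rw [h3]
  simp only [← Finset.sum_add_distrib]
  refine Finset.sum_congr rfl fun a _ => Finset.sum_congr rfl fun b _ =>
      Finset.sum_congr rfl fun c _ => Finset.sum_congr rfl fun e _ => ?_
  ring

end VectorMoments

end


/-! ### Mean and covariance of one score increment. -/

noncomputable section

section Integrable

variable {α : Type*} [MeasurableSpace α] {μ : Measure α} {f g : α → ℝ}

theorem integrable_fun_add (hf : Integrable f μ) (hg : Integrable g μ) :
    Integrable (fun x => f x + g x) μ :=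
  hf.add hg

theorem integrable_fun_sub (hf : Integrable f μ) (hg : Integrable g μ) :
    Integrable (fun x => f x - g x) μ :=
  hf.sub hg

end Integrable

section ScoreTerm

variable {d : ℕ}

/-- The contribution of an innovation `v` with sensitivity `b`, covariance `S` and covariance
sensitivity `dS` to the score. -/
def scoreTerm (S dS : Matrix (Fin d) (Fin d) ℝ) (b v : Fin d → ℝ) : ℝ :=
  (1 / 2) * (v ⬝ᵥ ((S⁻¹ * dS * S⁻¹) *ᵥ v)) - (1 / 2) * (S⁻¹ * dS).trace - (S⁻¹ *ᵥ b) ⬝ᵥ v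

/-- The contribution of an innovation to the Fisher information. -/
def infoEntry (S dS dS' : Matrix (Fin d) (Fin d) ℝ) (b b' : Fin d → ℝ) : ℝ :=
  b ⬝ᵥ (S⁻¹ *ᵥ b') + (1 / 2) * (S⁻¹ * dS * S⁻¹ * dS').trace

variable {S : Matrix (Fin d) (Fin d) ℝ}

theorem inv_mul_mul_inv_mul (hS : S.PosDef) (dS : Matrix (Fin d) (Fin d) ℝ) :
    S⁻¹ * dS * S⁻¹ * S = S⁻¹ * dS := by
  rw [Matrix.mul_assoc _ S⁻¹ S, Matrix.nonsing_inv_mul _ (posDef_isUnit_det hS), Matrix.mul_one]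

/-- The quadratic form has mean `tr(S⁻¹ dS)`, which the trace term cancels; the linear term is odd.
-/
theorem integral_scoreTerm (hS : S.PosDef) (dS : Matrix (Fin d) (Fin d) ℝ) (b : Fin d → ℝ) :
    ∫ v, scoreTerm S dS b v ∂gaussVec 0 S = 0 := by
  have hq := ((memLp_quadratic_gaussVec 0 S (S⁻¹ * dS * S⁻¹)).integrable one_le_two).const_mul
    (1 / 2)
  have hl := (memLp_dotProduct_gaussVec 0 S (p := 1) (by simp) (S⁻¹ *ᵥ b)).integrable le_rfl
  have hc := integrable_const (μ := gaussVec 0 S) ((1 / 2) * (S⁻¹ * dS).trace)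
  have hl0 : ∫ v, (S⁻¹ *ᵥ b) ⬝ᵥ v ∂gaussVec 0 S = 0 :=
    integral_odd_gaussVec hS.posSemidef fun v => dotProduct_neg _ _
  unfold scoreTerm
  rw [integral_sub (integrable_fun_sub hq hc) hl, integral_sub hq hc, integral_const_mul,
    integral_quadratic_gaussVec hS.posSemidef, inv_mul_mul_inv_mul hS, hl0]
  simp

/-- The centred quadratic parts contribute `½ tr(S⁻¹ dS S⁻¹ dS')`, the linear parts `bᵀ S⁻¹ b'`, and
the mixed products are odd in `v`. -/
theorem integral_scoreTerm_mul_scoreTerm (hS : S.PosDef) (dS dS' : Matrix (Fin d) (Fin d) ℝ)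
    (hdS' : dS'ᵀ = dS') (b b' : Fin d → ℝ) :
    ∫ v, scoreTerm S dS b v * scoreTerm S dS' b' v ∂gaussVec 0 S = infoEntry S dS dS' b b' := by
  have hSt : S⁻¹ᵀ = S⁻¹ := by rw [transpose_nonsing_inv, posDef_transpose hS]
  set W := S⁻¹ * dS * S⁻¹ with hW
  set W' := S⁻¹ * dS' * S⁻¹ with hW'
  set l := S⁻¹ *ᵥ b with hl
  set l' := S⁻¹ *ᵥ b' with hl'
  set τ := (S⁻¹ * dS).trace with hτ
  set τ' := (S⁻¹ * dS').trace with hτ'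
  have hW't : W'ᵀ = W' := by
    rw [hW', transpose_mul, transpose_mul, hSt, hdS', Matrix.mul_assoc]
  have hq := memLp_quadratic_gaussVec 0 S W
  have hq' := memLp_quadratic_gaussVec 0 S W'
  have hL := memLp_dotProduct_gaussVec 0 S (p := 2) (by simp) l
  have hL' := memLp_dotProduct_gaussVec 0 S (p := 2) (by simp) l'
  have i1 : Integrable (fun v => (1 / 4) * ((v ⬝ᵥ (W *ᵥ v)) * (v ⬝ᵥ (W' *ᵥ v)))) (gaussVec 0 S) :=
    (hq.integrable_mul hq').const_mul _
  have i2 : Integrable (fun v => (τ' / 4) * (v ⬝ᵥ (W *ᵥ v))) (gaussVec 0 S) :=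
    (hq.integrable one_le_two).const_mul _
  have i3 : Integrable (fun v => (τ / 4) * (v ⬝ᵥ (W' *ᵥ v))) (gaussVec 0 S) :=
    (hq'.integrable one_le_two).const_mul _
  have i4 : Integrable (fun v => (l ⬝ᵥ v) * (l' ⬝ᵥ v)) (gaussVec 0 S) := hL.integrable_mul hL'
  have i5 : Integrable (fun v => (1 / 2) * (v ⬝ᵥ (W *ᵥ v) - τ) * (l' ⬝ᵥ v)
      + (1 / 2) * (v ⬝ᵥ (W' *ᵥ v) - τ') * (l ⬝ᵥ v)) (gaussVec 0 S) :=
    (((hq.sub (memLp_const τ)).const_mul (1 / 2)).integrable_mul hL').add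
      (((hq'.sub (memLp_const τ')).const_mul (1 / 2)).integrable_mul hL)
  have hodd : ∫ v, ((1 / 2) * (v ⬝ᵥ (W *ᵥ v) - τ) * (l' ⬝ᵥ v)
      + (1 / 2) * (v ⬝ᵥ (W' *ᵥ v) - τ') * (l ⬝ᵥ v)) ∂gaussVec 0 S = 0 :=
    integral_odd_gaussVec hS.posSemidef fun v => by
      simp only [mulVec_neg, neg_dotProduct, dotProduct_neg, neg_neg]
      ring
  have e : ∀ v, scoreTerm S dS b v * scoreTerm S dS' b' v
      = (1 / 4) * ((v ⬝ᵥ (W *ᵥ v)) * (v ⬝ᵥ (W' *ᵥ v))) - (τ' / 4) * (v ⬝ᵥ (W *ᵥ v))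
        - (τ / 4) * (v ⬝ᵥ (W' *ᵥ v)) + τ * τ' / 4 + (l ⬝ᵥ v) * (l' ⬝ᵥ v)
        - ((1 / 2) * (v ⬝ᵥ (W *ᵥ v) - τ) * (l' ⬝ᵥ v)
          + (1 / 2) * (v ⬝ᵥ (W' *ᵥ v) - τ') * (l ⬝ᵥ v)) := by
    intro v
    simp only [scoreTerm, ← hW, ← hW', ← hl, ← hl', ← hτ, ← hτ']
    ring
  have hll : l ⬝ᵥ (S *ᵥ l') = b ⬝ᵥ (S⁻¹ *ᵥ b') := by
    rw [hl', mulVec_mulVec, Matrix.mul_nonsing_inv _ (posDef_isUnit_det hS), one_mulVec, hl,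
      dotProduct_mulVec, ← mulVec_transpose, hSt]
  have htr : (W * S * W' * S).trace = (S⁻¹ * dS * S⁻¹ * dS').trace := by
    rw [Matrix.mul_assoc (W * S), hW, hW', inv_mul_mul_inv_mul hS, inv_mul_mul_inv_mul hS]
    simp only [Matrix.mul_assoc]
  simp_rw [e]
  have j2 := integrable_fun_sub i1 i2
  have j3 := integrable_fun_sub j2 i3
  have j4 := integrable_fun_add j3 (integrable_const (τ * τ' / 4))
  rw [integral_sub (integrable_fun_add j4 i4) i5, integral_add j4 i4,
    integral_add j3 (integrable_const _), integral_sub j2 i3,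
    integral_sub i1 i2, integral_const_mul, integral_const_mul, integral_const_mul, hodd,
    integral_quadratic_mul_quadratic hS.posSemidef W W' hW't,
    integral_quadratic_gaussVec hS.posSemidef, integral_quadratic_gaussVec hS.posSemidef,
    integral_dotProduct_mul hS.posSemidef, hll, htr, hW, hW', inv_mul_mul_inv_mul hS,
    inv_mul_mul_inv_mul hS, infoEntry]
  simp only [integral_const, probReal_univ, one_smul]
  ring

end ScoreTerm

section LpVec

variable {α : Type*} [MeasurableSpace α] {μ : Measure α} {d e : ℕ} {p : ENNReal}

theorem memLp_mulVec (A : Matrix (Fin e) (Fin d) ℝ) {f : α → Fin d → ℝ} (hf : MemLp f p μ) :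
    MemLp (fun x => A *ᵥ f x) p μ :=
  (LinearMap.toContinuousLinearMap (Matrix.mulVecLin A)).comp_memLp' hf

theorem memLp_eval {f : α → Fin d → ℝ} (hf : MemLp f p μ) (k : Fin d) :
    MemLp (fun x => f x k) p μ :=
  (ContinuousLinearMap.proj (R := ℝ) (φ := fun _ : Fin d => ℝ) k).comp_memLp' hf

theorem integrable_dotProduct {f g : α → Fin d → ℝ} (hf : MemLp f 2 μ) (hg : MemLp g 2 μ) :
    Integrable (fun x => f x ⬝ᵥ g x) μ :=
  integrable_finsetSum _ fun k _ => (memLp_eval hf k).integrable_mul (memLp_eval hg k)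

/-- The linear part of the score multiplies a random sensitivity by the innovation. Because they
live on different factors, second moments of each suffice for a second moment of the product. -/
theorem memLp_dotProduct_prod {β : Type*} [MeasurableSpace β] {ν : Measure β} [SFinite μ]
    [SFinite ν] {f : α → Fin d → ℝ} {g : β → Fin d → ℝ} (hf : MemLp f 2 μ) (hg : MemLp g 2 ν) :
    MemLp (fun q : α × β => f q.1 ⬝ᵥ g q.2) 2 (μ.prod ν) := by
  refine memLp_finsetSum _ fun k _ => ?_
  have h1 := memLp_eval hf k
  have h2 := memLp_eval hg k
  have hm : AEStronglyMeasurable (fun q : α × β => f q.1 k * g q.2 k) (μ.prod ν) :=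
    h1.aestronglyMeasurable.comp_fst.mul h2.aestronglyMeasurable.comp_snd
  rw [memLp_two_iff_integrable_sq hm]
  simp_rw [mul_pow]
  exact h1.integrable_sq.mul_prod h2.integrable_sq

end LpVec

variable {ι : Type*} {dx du dy : ℕ}

namespace Model

/-! ### Causality, measurability and moments of the filter as a function of the data. -/

section Causality

variable (M : Model ι dx du dy) (θ : ι → ℝ) {T T' : ℕ} {y : Fin T → Fin dy → ℝ}
  {y' : Fin T' → Fin dy → ℝ} {t : ℕ}

/-- The two records may have different lengths, so a record can be compared with its extension by
one observation. -/
theorem filtMean_congr (h : ∀ s < t, obs y s = obs y' s) :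
    M.filtMean θ y t = M.filtMean θ y' t := by
  induction t with
  | zero => rfl
  | succ t ih => simp only [filtMean, ih fun s hs => h s (by omega), h t (by omega)]

theorem predMean_congr (h : ∀ s < t, obs y s = obs y' s) :
    M.predMean θ y t = M.predMean θ y' t := by
  rw [predMean, predMean, M.filtMean_congr θ h]

theorem innov_congr (h : ∀ s ≤ t, obs y s = obs y' s) :
    M.innov θ y t = M.innov θ y' t := by
  rw [innov, innov, M.predMean_congr θ fun s hs => h s hs.le, h t le_rfl]

variable [Fintype ι] [DecidableEq ι] (i : ι)

theorem dFiltMean_congr (h : ∀ s < t, obs y s = obs y' s) :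
    M.dFiltMean θ y i t = M.dFiltMean θ y' i t := by
  induction t with
  | zero => rfl
  | succ t ih =>
    have h' : ∀ s < t, obs y s = obs y' s := fun s hs => h s (by omega)
    simp only [dFiltMean, ih h', M.filtMean_congr θ h', M.predMean_congr θ h',
      M.innov_congr θ (t := t) fun s hs => h s (by omega)]

/-- Unlike the innovation itself, its sensitivity ignores the current observation, which is held
fixed in the differentiation. This makes the score increments martingale differences. -/
theorem dInnov_congr (h : ∀ s < t, obs y s = obs y' s) :
    M.dInnov θ y i t = M.dInnov θ y' i t := by
  simp only [dInnov, dPredMean, M.filtMean_congr θ h, M.predMean_congr θ h,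
    M.dFiltMean_congr θ i h]

end Causality

theorem obs_snoc_of_lt {T : ℕ} (y : Fin T → Fin dy → ℝ) (a : Fin dy → ℝ) {s : ℕ} (hs : s < T) :
    obs (Fin.snoc (α := fun _ => Fin dy → ℝ) y a) s = obs y s := by
  have h1 : s < T + 1 := by omega
  have h2 : (⟨s, h1⟩ : Fin (T + 1)) = Fin.castSucc ⟨s, hs⟩ := rfl
  rw [obs, obs, dif_pos h1, dif_pos hs, h2, Fin.snoc_castSucc (α := fun _ => Fin dy → ℝ)]

theorem obs_snoc_self {T : ℕ} (y : Fin T → Fin dy → ℝ) (a : Fin dy → ℝ) :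
    obs (Fin.snoc (α := fun _ => Fin dy → ℝ) y a) T = a := by
  have h2 : (⟨T, Nat.lt_succ_self T⟩ : Fin (T + 1)) = Fin.last T := rfl
  rw [obs, dif_pos (Nat.lt_succ_self T), h2, Fin.snoc_last (α := fun _ => Fin dy → ℝ)]

section Measurability

variable (M : Model ι dx du dy) (θ : ι → ℝ) {T : ℕ}

theorem measurable_obs (t : ℕ) : Measurable (fun y : Fin T → Fin dy → ℝ => obs y t) := by
  unfold obs
  split <;> fun_prop

theorem measurable_filtMean (t : ℕ) :
    Measurable (fun y : Fin T → Fin dy → ℝ => M.filtMean θ y t) := by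
  induction t with
  | zero => exact measurable_const
  | succ t ih =>
    have := measurable_obs (dy := dy) (T := T) t
    simp only [filtMean]
    fun_prop

theorem measurable_predMean (t : ℕ) :
    Measurable (fun y : Fin T → Fin dy → ℝ => M.predMean θ y t) := by
  have := M.measurable_filtMean θ (T := T) t
  unfold predMean
  fun_prop

end Measurability

section Moments

variable (M : Model ι dx du dy) (θ : ι → ℝ) {T : ℕ} {μ : Measure (Fin T → Fin dy → ℝ)}
  [IsFiniteMeasure μ] {p : ENNReal}

theorem memLp_obs (h : ∀ t, MemLp (fun y => y t) p μ) (t : ℕ) : MemLp (fun y => obs y t) p μ := by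
  unfold obs
  split
  · exact h _
  -- Past the end of the record `obs` is the constant zero.
  · exact memLp_const 0

theorem memLp_filtMean (h : ∀ t, MemLp (fun y => y t) p μ) (t : ℕ) :
    MemLp (fun y => M.filtMean θ y t) p μ := by
  induction t with
  | zero => exact memLp_const _
  | succ t ih =>
    have h1 := (memLp_mulVec (M.A θ) ih).add (memLp_const (M.B θ *ᵥ M.input t))
    exact h1.add (memLp_mulVec _ ((memLp_obs h t).sub (memLp_mulVec _ h1)))

theorem memLp_predMean (h : ∀ t, MemLp (fun y => y t) p μ) (t : ℕ) :
    MemLp (fun y => M.predMean θ y t) p μ :=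
  (memLp_mulVec (M.A θ) (M.memLp_filtMean θ h t)).add (memLp_const (M.B θ *ᵥ M.input t))

theorem memLp_innov (h : ∀ t, MemLp (fun y => y t) p μ) (t : ℕ) :
    MemLp (fun y => M.innov θ y t) p μ :=
  (memLp_obs h t).sub (memLp_mulVec _ (M.memLp_predMean θ h t))

variable [Fintype ι] [DecidableEq ι] (i : ι)

theorem memLp_dFiltMean (h : ∀ t, MemLp (fun y => y t) p μ) (t : ℕ) :
    MemLp (fun y => M.dFiltMean θ y i t) p μ := by
  induction t with
  | zero => exact memLp_const _
  | succ t ih =>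
    have h1 := ((memLp_mulVec (matDeriv i M.A θ) (M.memLp_filtMean θ h t)).add
      (memLp_mulVec (M.A θ) ih)).add (memLp_const (matDeriv i M.B θ *ᵥ M.input t))
    exact (h1.add (memLp_mulVec _ (M.memLp_innov θ h t))).add (memLp_mulVec _
      ((memLp_mulVec (M.C θ) h1).neg.sub (memLp_mulVec _ (M.memLp_predMean θ h t))))

theorem memLp_dInnov (h : ∀ t, MemLp (fun y => y t) p μ) (t : ℕ) :
    MemLp (fun y => M.dInnov θ y i t) p μ := by
  have h1 := ((memLp_mulVec (matDeriv i M.A θ) (M.memLp_filtMean θ h t)).add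
      (memLp_mulVec (M.A θ) (M.memLp_dFiltMean θ i h t))).add
        (memLp_const (matDeriv i M.B θ *ᵥ M.input t))
  exact (memLp_mulVec (M.C θ) h1).neg.sub (memLp_mulVec _ (M.memLp_predMean θ h t))

end Moments

end Model

end


/-! ### Score, innovation representation of the outputs and Fisher information. -/

noncomputable section

theorem continuous_dotProduct_pair {d : ℕ} :
    Continuous (fun q : (Fin d → ℝ) × (Fin d → ℝ) => q.1 ⬝ᵥ q.2) := by
  unfold dotProduct
  fun_prop

theorem continuous_mulVec {d e : ℕ} (A : Matrix (Fin e) (Fin d) ℝ) :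
    Continuous (fun v : Fin d → ℝ => A *ᵥ v) := by
  unfold mulVec dotProduct
  fun_prop

theorem continuous_scoreTerm {d : ℕ} (S dS : Matrix (Fin d) (Fin d) ℝ) :
    Continuous (fun q : (Fin d → ℝ) × (Fin d → ℝ) => scoreTerm S dS q.1 q.2) := by
  unfold scoreTerm
  have h1 := continuous_dotProduct_pair.comp
    (continuous_snd.prodMk ((continuous_mulVec (S⁻¹ * dS * S⁻¹)).comp
      (continuous_snd (X := Fin d → ℝ) (Y := Fin d → ℝ))))
  have h2 := continuous_dotProduct_pair.comp
    (((continuous_mulVec S⁻¹).comp continuous_fst).prodMk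
      (continuous_snd (X := Fin d → ℝ) (Y := Fin d → ℝ)))
  exact ((continuous_const.mul h1).sub continuous_const).sub h2

theorem transpose_mul_mul_apply {m n ι κ : Type*} [Fintype m] [Fintype n] (X : Matrix m ι ℝ)
    (K : Matrix m n ℝ) (Y : Matrix n κ ℝ) (i : ι) (j : κ) :
    (Xᵀ * K * Y) i j = (fun k => X k i) ⬝ᵥ (K *ᵥ fun k => Y k j) := by
  rw [Matrix.mul_assoc]
  rfl

variable {ι : Type*} {dx du dy : ℕ}

namespace Model

section Score

variable [Fintype ι] [DecidableEq ι] {M : Model ι dx du dy} {θ : ι → ℝ} {T : ℕ}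

/-- The contribution of the observation at time `t + 1` to the score. -/
def scoreAt (M : Model ι dx du dy) (θ : ι → ℝ) (y : Fin T → Fin dy → ℝ) (i : ι) (t : ℕ) : ℝ :=
  scoreTerm (M.innovCov θ t) (M.dInnovCov θ i t) (M.dInnov θ y i t) (M.innov θ y t)

/-- Inherited from the symmetry of `S` at all parameter values, without looking at the recursion. -/
theorem transpose_dInnovCov (h0 : M.initCov.PosSemidef) (hw : M.procCov.PosSemidef)
    (hz : M.measCov.PosDef) (i : ι) (t : ℕ) : (M.dInnovCov θ i t)ᵀ = M.dInnovCov θ i t := by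
  have h := hasMatGrad_innovCov (θ := θ) h0 hw hz t
  have h1 := h.transpose
  simp only [fun θ' => posDef_transpose (posDef_innovCov h0 hw hz θ' t)] at h1
  rw [← h1.matDeriv_eq i, h.matDeriv_eq i]

/-- `(S⁻¹ ⊗ S⁻¹) vec X = vec (S⁻¹ X S⁻¹)` for symmetric `S`, and the dot product of two
vectorizations is a trace. -/
theorem infoTerm_apply (h0 : M.initCov.PosSemidef) (hw : M.procCov.PosSemidef)
    (hz : M.measCov.PosDef) (y : Fin T → Fin dy → ℝ) (t : ℕ) (i j : ι) :
    M.infoTerm θ y t i j = infoEntry (M.innovCov θ t) (M.dInnovCov θ i t) (M.dInnovCov θ j t)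
      (M.dInnov θ y i t) (M.dInnov θ y j t) := by
  have hSt : (M.innovCov θ t)⁻¹ᵀ = (M.innovCov θ t)⁻¹ := by
    rw [transpose_nonsing_inv, posDef_transpose (posDef_innovCov h0 hw hz θ t)]
  have hν : ∀ i, (fun k => jacobian (fun θ' => M.innov θ' y t) θ k i) = M.dInnov θ y i t :=
    fun i => funext fun k => (hasVecGrad_innov h0 hw hz y t).jacobian_apply k i
  have hS : ∀ i, (fun k => jacobian (fun θ' => (M.innovCov θ' t).vec) θ k i)
      = (M.dInnovCov θ i t).vec :=
    -- `vec` stacks columns, so its index is the pair (column, row).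
    fun i => funext fun k => (hasMatGrad_innovCov h0 hw hz t k.2 k.1).2 i
  rw [infoTerm, Matrix.add_apply, Matrix.smul_apply, transpose_mul_mul_apply,
    transpose_mul_mul_apply, hν, hν, hS, hS, kronecker_mulVec_vec, vec_dotProduct_vec,
    transpose_dInnovCov h0 hw hz, hSt, infoEntry, smul_eq_mul, ← Matrix.mul_assoc,
    ← Matrix.mul_assoc, Matrix.trace_mul_comm]
  simp only [Matrix.mul_assoc]

theorem aestronglyMeasurable_scoreAt {μ : Measure (Fin T → Fin dy → ℝ)} [IsFiniteMeasure μ]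
    (h : ∀ t, MemLp (fun y => y t) 2 μ) (i : ι) (t : ℕ) :
    AEStronglyMeasurable (fun y => M.scoreAt θ y i t) μ := by
  have hp : AEStronglyMeasurable (fun y => (M.dInnov θ y i t, M.innov θ y t)) μ :=
    (M.memLp_dInnov θ i h t).aestronglyMeasurable.prodMk
      (M.memLp_innov θ h t).aestronglyMeasurable
  exact Continuous.comp_aestronglyMeasurable (g := fun q : (Fin dy → ℝ) × (Fin dy → ℝ) =>
    scoreTerm (M.innovCov θ t) (M.dInnovCov θ i t) q.1 q.2)
    (f := fun y => (M.dInnov θ y i t, M.innov θ y t)) (continuous_scoreTerm _ _) hp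

theorem integrable_infoEntry {μ : Measure (Fin T → Fin dy → ℝ)} [IsFiniteMeasure μ]
    (h : ∀ t, MemLp (fun y => y t) 2 μ) (S dS dS' : Matrix (Fin dy) (Fin dy) ℝ) (i j : ι) (t : ℕ) :
    Integrable (fun y => infoEntry S dS dS' (M.dInnov θ y i t) (M.dInnov θ y j t)) μ :=
  (integrable_dotProduct (M.memLp_dInnov θ i h t) (memLp_mulVec _ (M.memLp_dInnov θ j h t))).add
    (integrable_const _)

end Score

section Law

variable {Ω : Type*} [MeasurableSpace Ω] {P : Measure Ω}
  {M : Model ι dx du dy} {x0 : Ω → Fin dx → ℝ} {w : ℕ → Ω → Fin dx → ℝ} {z : ℕ → Ω → Fin dy → ℝ}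

theorem _root_.LTI.IsGaussianVector.memLp {d : ℕ} {X : Ω → Fin d → ℝ} {m : Fin d → ℝ}
    {S : Matrix (Fin d) (Fin d) ℝ} (h : IsGaussianVector X m S P) {p : ENNReal} (hp : p ≠ ⊤) :
    MemLp X p P := by
  obtain ⟨hm, hl⟩ := isGaussianVector_iff_map h
  have h1 := memLp_id_gaussVec m S hp
  rw [← hl] at h1
  exact (memLp_map_measure_iff aestronglyMeasurable_id hm).mp h1

theorem aemeasurable_output (h : IsNoise M P x0 w z) (T : ℕ) (θ : ι → ℝ) :
    AEMeasurable (M.output T x0 w z θ) P :=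
  aemeasurable_pi_lambda _ fun t =>
    ((measurable_mulVec (M.C θ)).comp_aemeasurable (h.aemeasurable_state θ (t + 1))).add
      (h.aemeasurable_meas _)

theorem isProbabilityMeasure_outputLaw [IsProbabilityMeasure P] (h : IsNoise M P x0 w z) (T : ℕ)
    (θ : ι → ℝ) : IsProbabilityMeasure (M.outputLaw T P x0 w z θ) :=
  Measure.isProbabilityMeasure_map (aemeasurable_output h T θ)

theorem memLp_output [IsFiniteMeasure P] (h : IsNoise M P x0 w z) (T : ℕ) (θ : ι → ℝ) (t : Fin T)
    {p : ENNReal} (hp : p ≠ ⊤) : MemLp (fun y => y t) p (M.outputLaw T P x0 w z θ) := by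
  have hx : ∀ s, MemLp (fun ω => M.state x0 w θ ω s) p P := by
    intro s
    induction s with
    | zero => exact h.law_init.memLp hp
    | succ s ih =>
      exact ((memLp_mulVec _ ih).add (memLp_const (M.B θ *ᵥ M.input s))).add
        ((h.law_proc s).memLp hp)
  refine (memLp_map_measure_iff (measurable_pi_apply t).aestronglyMeasurable
    (aemeasurable_output h T θ)).mpr ?_
  exact (memLp_mulVec (M.C θ) (hx (t + 1))).add ((h.law_meas _).memLp hp)

theorem measurable_snoc {T : ℕ} : Measurable (fun q : (Fin T → Fin dy → ℝ) × (Fin dy → ℝ) =>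
    (Fin.snoc (α := fun _ => Fin dy → ℝ) q.1 q.2 : Fin (T + 1) → Fin dy → ℝ)) := by
  refine measurable_pi_lambda _ fun t => ?_
  refine Fin.lastCases ?_ (fun s => ?_) t
  · simp only [Fin.snoc_last]; fun_prop
  · simp only [Fin.snoc_castSucc]; fun_prop

theorem lintegral_snoc {T : ℕ} {f : (Fin (T + 1) → Fin dy → ℝ) → ENNReal} (hf : Measurable f) :
    ∫⁻ y, f y = ∫⁻ y : Fin T → Fin dy → ℝ, ∫⁻ a : Fin dy → ℝ,
      f (Fin.snoc (α := fun _ => Fin dy → ℝ) y a) := by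
  have h := (volume_preserving_piFinSuccAbove (fun _ : Fin (T + 1) => Fin dy → ℝ)
    (Fin.last T)).symm
  rw [← h.lintegral_comp hf]
  have hsnoc : ∀ q : (Fin dy → ℝ) × (Fin T → Fin dy → ℝ),
      (MeasurableEquiv.piFinSuccAbove (fun _ : Fin (T + 1) => Fin dy → ℝ) (Fin.last T)).symm q
        = Fin.snoc (α := fun _ => Fin dy → ℝ) q.2 q.1 := by
    intro q
    rw [MeasurableEquiv.piFinSuccAbove_symm_apply, Fin.insertNthEquiv, Equiv.coe_fn_mk,
      Fin.insertNth_last']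
  simp_rw [hsnoc]
  exact lintegral_prod_symm (μ := volume) (ν := volume)
    (fun q : (Fin dy → ℝ) × (Fin T → Fin dy → ℝ) =>
      f (Fin.snoc (α := fun _ => Fin dy → ℝ) q.2 q.1))
    (hf.comp (measurable_snoc.comp measurable_swap)).aemeasurable

theorem gaussianDensity_add {d : ℕ} (c v : Fin d → ℝ) (S : Matrix (Fin d) (Fin d) ℝ) :
    gaussianDensity c S (c + v) = gaussianDensity 0 S v := by
  simp [gaussianDensity]

/-- The next innovation is Gaussian and independent of the past outputs. -/
theorem outputLaw_succ [IsProbabilityMeasure P] (h0 : M.initCov.PosSemidef)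
    (hw : M.procCov.PosSemidef) (hz : M.measCov.PosDef) (h : IsNoise M P x0 w z) (T : ℕ)
    (θ : ι → ℝ) :
    M.outputLaw (T + 1) P x0 w z θ
      = ((M.outputLaw T P x0 w z θ).prod (gaussVec 0 (M.innovCov θ T))).map (fun q =>
        Fin.snoc (α := fun _ => Fin dy → ℝ) q.1 (M.C θ *ᵥ M.predMean θ q.1 T + q.2)) := by
  have hS := posDef_innovCov h0 hw hz θ T
  have hpm := M.measurable_predMean θ (T := T) T
  have hΦ : Measurable (fun q : (Fin T → Fin dy → ℝ) × (Fin dy → ℝ) =>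
      (Fin.snoc (α := fun _ => Fin dy → ℝ) q.1 (M.C θ *ᵥ M.predMean θ q.1 T + q.2) :
        Fin (T + 1) → Fin dy → ℝ)) :=
    measurable_snoc.comp (measurable_fst.prodMk
      ((((measurable_mulVec _).comp hpm).comp measurable_fst).add measurable_snd))
  have hlm : ∀ T, Measurable (fun y : Fin T → Fin dy → ℝ =>
      ENNReal.ofReal (M.likelihood T P x0 w θ y)) := fun T => by
    simp_rw [likelihood_eq_prod h0 hw hz h]
    exact (Finset.measurable_prod _ fun t _ => measurable_gaussianDensity_comp
      ((measurable_mulVec _).comp (M.measurable_predMean θ t)) (measurable_obs t) _).ennreal_ofReal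
  have := isProbabilityMeasure_outputLaw h T θ
  refine Measure.ext_of_lintegral _ fun f hf => ?_
  have hfΦ : Measurable (fun q : (Fin T → Fin dy → ℝ) × (Fin dy → ℝ) =>
      f (Fin.snoc (α := fun _ => Fin dy → ℝ) q.1 (M.C θ *ᵥ M.predMean θ q.1 T + q.2))) :=
    hf.comp hΦ
  rw [lintegral_map hf hΦ, lintegral_prod _ hfΦ.aemeasurable,
    outputLaw_eq_withDensity h0 hw hz h, outputLaw_eq_withDensity h0 hw hz h,
    lintegral_withDensity_eq_lintegral_mul _ (hlm _) hf,
    lintegral_withDensity_eq_lintegral_mul _ (hlm _) hfΦ.lintegral_prod_right',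
    lintegral_snoc ((hlm _).mul hf)]
  refine lintegral_congr fun y => ?_
  have hfy : Measurable fun v => f (Fin.snoc (α := fun _ => Fin dy → ℝ) y
      (M.C θ *ᵥ M.predMean θ y T + v)) := by
    have := hfΦ.comp (measurable_prodMk_left (x := y))
    simpa only [Function.comp_def] using this
  -- By causality the first `T` factors depend on `y` alone, and the last is a Gaussian density in
  -- `a` centred at the prediction from `y`.
  have hlik : ∀ a, M.likelihood (T + 1) P x0 w θ (Fin.snoc (α := fun _ => Fin dy → ℝ) y a)
      = M.likelihood T P x0 w θ y
        * gaussianDensity (M.C θ *ᵥ M.predMean θ y T) (M.innovCov θ T) a := by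
    intro a
    rw [likelihood_eq_prod h0 hw hz h, likelihood_eq_prod h0 hw hz h, Finset.prod_range_succ,
      obs_snoc_self, M.predMean_congr θ fun s hs => obs_snoc_of_lt y a hs]
    congr 1
    refine Finset.prod_congr rfl fun t ht => ?_
    have ht := Finset.mem_range.mp ht
    rw [obs_snoc_of_lt y a ht, M.predMean_congr θ fun s hs => obs_snoc_of_lt y a (hs.trans ht)]
  simp only [Pi.mul_apply, hlik]
  -- The last observation is replaced by its innovation, `a = C x̂ + v`, by translation invariance.
  rw [gaussVec_eq_withDensity _ hS, lintegral_withDensity_eq_lintegral_mul _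
    (measurable_gaussianDensity _ _).ennreal_ofReal hfy, ← lintegral_const_mul _
      ((measurable_gaussianDensity _ _).ennreal_ofReal.mul hfy),
    ← lintegral_add_left_eq_self _ (M.C θ *ᵥ M.predMean θ y T)]
  refine lintegral_congr fun v => ?_
  rw [gaussianDensity_add, ENNReal.ofReal_mul (likelihood_pos h0 hw hz h θ y).le, Pi.mul_apply,
    mul_assoc]

end Law

section Fisher

variable [Fintype ι] [DecidableEq ι] {Ω : Type*} [MeasurableSpace Ω] {P : Measure Ω}
  [IsProbabilityMeasure P] {M : Model ι dx du dy} {x0 : Ω → Fin dx → ℝ} {w : ℕ → Ω → Fin dx → ℝ}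
  {z : ℕ → Ω → Fin dy → ℝ}

/-- Differentiates the explicit prediction error decomposition; the two terms containing `∂ν` merge
by the symmetry of `S⁻¹`. -/
theorem hasGrad_logLikelihood (h0 : M.initCov.PosSemidef) (hw : M.procCov.PosSemidef)
    (hz : M.measCov.PosDef) (h : IsNoise M P x0 w z) {T : ℕ} (θ : ι → ℝ)
    (y : Fin T → Fin dy → ℝ) :
    HasGrad (fun θ' => M.logLikelihood T P x0 w θ' y)
      (fun i => ∑ t ∈ Finset.range T, M.scoreAt θ y i t) θ := by
  simp_rw [logLikelihood_eq h0 hw hz h]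
  have hu := fun t θ' => posDef_isUnit_det (posDef_innovCov h0 hw hz θ' t)
  refine ((HasGrad.const _).sub ((HasGrad.sum fun t _ =>
    ((hasMatGrad_innovCov h0 hw hz t).log_det (hu t θ)).add
      ((hasVecGrad_innov h0 hw hz y t).dotProduct
        (((hasMatGrad_innovCov h0 hw hz t).inv (hu t)).mulVec
          (hasVecGrad_innov h0 hw hz y t)))).const_mul _)).congr_grad fun i => ?_
  rw [zero_sub, Finset.mul_sum, ← Finset.sum_neg_distrib]
  refine Finset.sum_congr rfl fun t _ => ?_
  have hsymm := posSemidef_symm (posDef_innovCov h0 hw hz θ t).inv.posSemidef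
    (M.dInnov θ y i t) (M.innov θ y t)
  rw [scoreAt, scoreTerm, dotProduct_comm (_ *ᵥ _) (M.innov θ y t), dotProduct_add, neg_mulVec,
    dotProduct_neg, hsymm]
  ring

/-- Induction on the horizon in the coordinates (past, new innovation). Square integrability is
carried along because it makes the cross terms integrable in the next step. -/
theorem memLp_and_integral_score (h0 : M.initCov.PosSemidef) (hw : M.procCov.PosSemidef)
    (hz : M.measCov.PosDef) (h : IsNoise M P x0 w z) (θ : ι → ℝ) (T : ℕ) :
    (∀ i, MemLp (fun y => ∑ t ∈ Finset.range T, M.scoreAt θ y i t) 2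
      (M.outputLaw T P x0 w z θ)) ∧
    ∀ i j, ∫ y, (∑ t ∈ Finset.range T, M.scoreAt θ y i t)
        * (∑ t ∈ Finset.range T, M.scoreAt θ y j t) ∂M.outputLaw T P x0 w z θ
      = ∑ t ∈ Finset.range T, ∫ y, infoEntry (M.innovCov θ t) (M.dInnovCov θ i t)
          (M.dInnovCov θ j t) (M.dInnov θ y i t) (M.dInnov θ y j t)
          ∂M.outputLaw T P x0 w z θ := by
  induction T with
  | zero => simp
  | succ T ih =>
    obtain ⟨ihL, ihI⟩ := ih
    have hS := posDef_innovCov h0 hw hz θ T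
    set S := M.innovCov θ T
    set μ := M.outputLaw T P x0 w z θ with hμ
    have hμp : IsProbabilityMeasure μ := isProbabilityMeasure_outputLaw h T θ
    have hμ'p := isProbabilityMeasure_outputLaw h (T + 1) θ
    have hL2 : ∀ t, MemLp (fun y => y t) 2 μ := fun t => memLp_output h T θ t (by simp)
    have hL2' : ∀ t, MemLp (fun y => y t) 2 (M.outputLaw (T + 1) P x0 w z θ) := fun t =>
      memLp_output h (T + 1) θ t (by simp)
    have hlaw := outputLaw_succ h0 hw hz h T θ
    set Φ : (Fin T → Fin dy → ℝ) × (Fin dy → ℝ) → Fin (T + 1) → Fin dy → ℝ := fun q =>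
      Fin.snoc (α := fun _ => Fin dy → ℝ) q.1 (M.C θ *ᵥ M.predMean θ q.1 T + q.2) with hΦdef
    have hΦ : Measurable Φ := measurable_snoc.comp (measurable_fst.prodMk
      ((((measurable_mulVec _).comp (M.measurable_predMean θ T)).comp measurable_fst).add
        measurable_snd))
    set σ : ι → (Fin T → Fin dy → ℝ) → ℝ := fun i y =>
      ∑ t ∈ Finset.range T, M.scoreAt θ y i t with hσ
    set s : ι → (Fin T → Fin dy → ℝ) × (Fin dy → ℝ) → ℝ := fun i q =>
      scoreTerm S (M.dInnovCov θ i T) (M.dInnov θ q.1 i T) q.2 with hs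
    have hobs : ∀ q : (Fin T → Fin dy → ℝ) × (Fin dy → ℝ), ∀ r < T, obs (Φ q) r = obs q.1 r :=
      fun q r hr => obs_snoc_of_lt _ _ hr
    have hdI : ∀ q i t, t ≤ T → M.dInnov θ (Φ q) i t = M.dInnov θ q.1 i t := fun q i t ht =>
      M.dInnov_congr θ i fun r hr => hobs q r (by omega)
    -- In these coordinates the new innovation is exactly the Gaussian variable `q.2`.
    have hI : ∀ q, M.innov θ (Φ q) T = q.2 := by
      intro q
      rw [innov, M.predMean_congr θ (hobs q), hΦdef, obs_snoc_self, add_sub_cancel_left]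
    have hsum : ∀ i q, ∑ t ∈ Finset.range (T + 1), M.scoreAt θ (Φ q) i t = σ i q.1 + s i q := by
      intro i q
      rw [Finset.sum_range_succ, scoreAt, hdI q i T le_rfl, hI]
      congr 1
      refine Finset.sum_congr rfl fun t ht => ?_
      have ht := Finset.mem_range.mp ht
      rw [scoreAt, scoreAt, hdI q i t ht.le,
        M.innov_congr θ (y' := q.1) fun r hr => hobs q r (by omega)]
    have hσL : ∀ i, MemLp (fun q : (Fin T → Fin dy → ℝ) × (Fin dy → ℝ) => σ i q.1) 2
        (μ.prod (gaussVec 0 S)) := fun i => (ihL i).comp_fst _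
    -- The quadratic part involves only `q.2`; the linear part pairs the sensitivity, a function of
    -- the past, with `q.2`.
    have hsL : ∀ i, MemLp (s i) 2 (μ.prod (gaussVec 0 S)) := fun i =>
      ((((memLp_quadratic_gaussVec 0 S _).const_mul _).sub (memLp_const _)).comp_snd μ).sub
        (memLp_dotProduct_prod (memLp_mulVec S⁻¹ (M.memLp_dInnov θ i hL2 T))
          (memLp_id_gaussVec 0 S (by simp)))
    have hmeas : ∀ i, AEStronglyMeasurable
        (fun y => ∑ t ∈ Finset.range (T + 1), M.scoreAt θ y i t)
        (M.outputLaw (T + 1) P x0 w z θ) := fun i =>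
      Finset.aestronglyMeasurable_fun_sum _ fun t _ => aestronglyMeasurable_scoreAt hL2' i t
    refine ⟨fun i => ?_, fun i j => ?_⟩
    · have hm := hmeas i
      rw [hlaw] at hm ⊢
      rw [memLp_map_measure_iff hm hΦ.aemeasurable]
      simp only [Function.comp_def, hsum]
      exact (hσL i).add (hsL i)
    · have hprod : AEStronglyMeasurable (fun y =>
          (∑ t ∈ Finset.range (T + 1), M.scoreAt θ y i t)
            * (∑ t ∈ Finset.range (T + 1), M.scoreAt θ y j t))
          (M.outputLaw (T + 1) P x0 w z θ) := (hmeas i).mul (hmeas j)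
      -- For `t ≤ T` the integrand depends only on the first `T` outputs, so the horizon of the law
      -- can be lowered.
      have hinfo : ∀ t ≤ T, ∫ y, infoEntry (M.innovCov θ t) (M.dInnovCov θ i t)
          (M.dInnovCov θ j t) (M.dInnov θ y i t) (M.dInnov θ y j t)
            ∂M.outputLaw (T + 1) P x0 w z θ
          = ∫ y, infoEntry (M.innovCov θ t) (M.dInnovCov θ i t)
          (M.dInnovCov θ j t) (M.dInnov θ y i t) (M.dInnov θ y j t) ∂μ := by
        intro t ht
        have hm := (integrable_infoEntry (θ := θ) (M := M) hL2' (M.innovCov θ t)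
          (M.dInnovCov θ i t) (M.dInnovCov θ j t) i j t).aestronglyMeasurable
        rw [hlaw] at hm ⊢
        rw [integral_map hΦ.aemeasurable hm]
        simp_rw [fun q i => hdI q i t ht]
        rw [integral_fun_fst (fun y => infoEntry (M.innovCov θ t) (M.dInnovCov θ i t)
          (M.dInnovCov θ j t) (M.dInnov θ y i t) (M.dInnov θ y j t))]
        simp [hμ]
      have i1 : Integrable (fun q : (Fin T → Fin dy → ℝ) × (Fin dy → ℝ) => σ i q.1 * σ j q.1)
          (μ.prod (gaussVec 0 S)) := (hσL i).integrable_mul (hσL j)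
      have i2 : ∀ i j, Integrable (fun q : (Fin T → Fin dy → ℝ) × (Fin dy → ℝ) =>
          σ i q.1 * s j q) (μ.prod (gaussVec 0 S)) := fun i j => (hσL i).integrable_mul (hsL j)
      have i4 : Integrable (fun q => s i q * s j q) (μ.prod (gaussVec 0 S)) :=
        (hsL i).integrable_mul (hsL j)
      have c1 : ∫ q, σ i q.1 * σ j q.1 ∂μ.prod (gaussVec 0 S) = ∫ y, σ i y * σ j y ∂μ := by
        rw [integral_fun_fst (fun y => σ i y * σ j y)]
        simp
      -- Integrating over the innovation first, the past factor is constant and the increment has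
      -- mean zero.
      have c2 : ∀ i j, ∫ q, σ i q.1 * s j q ∂μ.prod (gaussVec 0 S) = 0 := by
        intro i j
        rw [integral_prod _ (i2 i j)]
        simp_rw [integral_const_mul, hs, integral_scoreTerm hS]
        simp
      have c4 : ∫ q, s i q * s j q ∂μ.prod (gaussVec 0 S) = ∫ y, infoEntry S (M.dInnovCov θ i T)
          (M.dInnovCov θ j T) (M.dInnov θ y i T) (M.dInnov θ y j T) ∂μ := by
        rw [integral_prod _ i4]
        simp_rw [hs, integral_scoreTerm_mul_scoreTerm hS _ _ (transpose_dInnovCov h0 hw hz j T)]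
      have e : ∀ q, (σ i q.1 + s i q) * (σ j q.1 + s j q)
          = σ i q.1 * σ j q.1 + σ i q.1 * s j q + σ j q.1 * s i q + s i q * s j q := by
        intro q
        ring
      rw [Finset.sum_range_succ, Finset.sum_congr rfl fun t ht =>
        hinfo t (Finset.mem_range.mp ht).le, hinfo T le_rfl, ← ihI i j, ← c4, ← c1]
      rw [hlaw] at hprod ⊢
      rw [integral_map hΦ.aemeasurable hprod]
      simp_rw [hsum, e]
      rw [integral_add (integrable_fun_add (integrable_fun_add i1 (i2 i j)) (i2 j i)) i4,
        integral_add (integrable_fun_add i1 (i2 i j)) (i2 j i), integral_add i1 (i2 i j),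
        c2 i j, c2 j i, add_zero, add_zero]

end Fisher

end Model

end


/-! ### Derivatives of the structured matrices and assembly of the result. -/

theorem matDeriv_map_eval_apply {ι m n : Type*} [Fintype ι] [DecidableEq ι] {θ : ι → ℝ}
    (E : Matrix m n (Entry ι)) (i : ι) (r : m) (s : n) :
    matDeriv i (fun θ' => E.map (Entry.eval θ')) θ r s = (E r s).grad i :=
  (Entry.hasGrad_eval (E r s)).2 i

theorem grad_companion_inl {n : ℕ} (k r s : Fin n) :
    (companion n Sum.inl r s : Entry (Fin n ⊕ Fin n)).grad (Sum.inl k)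
      = if (r : ℕ) + 1 = n ∧ s = k.rev then -1 else 0 := by
  -- The companion matrix places parameter `s.rev` in column `s`, so the column of parameter `k` is
  -- found by inverting the involution `rev`.
  have h : k = s.rev ↔ s = k.rev := by rw [eq_comm, Fin.rev_eq_iff]
  simp only [companion, Matrix.of_apply]
  split_ifs <;> simp_all [Entry.grad]

theorem grad_companion_inr {n : ℕ} (k r s : Fin n) :
    (companion n Sum.inl r s : Entry (Fin n ⊕ Fin n)).grad (Sum.inr k) = 0 := by
  simp only [companion, Matrix.of_apply]
  split_ifs <;> simp [Entry.grad]

end LTI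

theorem propositionC3 :
    -- the statement for every structured form
    (∀ {ι : Type*} [Fintype ι] [DecidableEq ι] {dx du dy : ℕ} {Ω : Type*} [MeasurableSpace Ω]
      (P : Measure Ω) [IsProbabilityMeasure P] (M : LTI.Model ι dx du dy)
      (x0 : Ω → Fin dx → ℝ) (w : ℕ → Ω → Fin dx → ℝ) (z : ℕ → Ω → Fin dy → ℝ),
      M.initCov.PosSemidef → M.procCov.PosSemidef → M.measCov.PosDef →
      LTI.IsNoise M P x0 w z →
      ∀ (T : ℕ) (θ : ι → ℝ),
        -- the innovation covariances are positive definite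
        (∀ t : ℕ, (M.innovCov θ t).PosDef) ∧
        -- the likelihood is the density of the outputs
        M.outputLaw T P x0 w z θ =
          volume.withDensity (fun y => ENNReal.ofReal (M.likelihood T P x0 w θ y)) ∧
        -- prediction error decomposition
        (∀ y : Fin T → Fin dy → ℝ,
          0 < M.likelihood T P x0 w θ y ∧
          M.logLikelihood T P x0 w θ y =
            -((T : ℝ) * (dy : ℝ) / 2) * Real.log (2 * Real.pi)
              - (1 / 2) * ∑ t ∈ Finset.range T,
                (Real.log (M.innovCov θ t).det
                  + M.innov θ y t ⬝ᵥ ((M.innovCov θ t)⁻¹ *ᵥ M.innov θ y t))) ∧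
        -- the score exists and is square integrable
        (∀ y : Fin T → Fin dy → ℝ,
          DifferentiableAt ℝ (fun θ' => M.logLikelihood T P x0 w θ' y) θ) ∧
        (∀ i : ι, MemLp (fun y => LTI.pderiv i (fun θ' => M.logLikelihood T P x0 w θ' y) θ) 2
          (M.outputLaw T P x0 w z θ)) ∧
        -- the Fisher information matrix
        (∀ t < T, ∀ i j : ι,
          Integrable (fun y => M.infoTerm θ y t i j) (M.outputLaw T P x0 w z θ)) ∧
        M.fisherInformation T P x0 w z θ =
          ∑ t ∈ Finset.range T,
            Matrix.of (fun i j => ∫ y, M.infoTerm θ y t i j ∂(M.outputLaw T P x0 w z θ)) ∧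
        -- the derivatives are obtained by propagation through the filter equations
        (∀ t < T,
          DifferentiableAt ℝ (fun θ' => (M.innovCov θ' t).vec) θ ∧
          (∀ i : ι, LTI.matDeriv i (fun θ' => M.innovCov θ' t) θ = M.dInnovCov θ i t) ∧
          ∀ y : Fin T → Fin dy → ℝ,
            DifferentiableAt ℝ (fun θ' => M.innov θ' y t) θ ∧
            ∀ (i : ι) (k : Fin dy),
              LTI.jacobian (fun θ' => M.innov θ' y t) θ k i = M.dInnov θ y i t k) ∧
        -- derivatives of fixed entries are zero
        (∀ (i : ι) (c : ℝ),
          (∀ r s, M.entryA r s = LTI.Entry.fixed c → LTI.matDeriv i M.A θ r s = 0) ∧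
          (∀ r s, M.entryB r s = LTI.Entry.fixed c → LTI.matDeriv i M.B θ r s = 0) ∧
          (∀ r s, M.entryC r s = LTI.Entry.fixed c → LTI.matDeriv i M.C θ r s = 0))) ∧
    -- the controller form: parameters `a_1, …, a_n, c_1, …, c_n`
    (∀ (n : ℕ) (θ : Fin n ⊕ Fin n → ℝ) (k : Fin n),
      LTI.matDeriv (Sum.inl k) (LTI.controllerForm n).A θ
        = Matrix.of (fun (i j : Fin n) => if (i : ℕ) + 1 = n ∧ j = k.rev then -1 else 0) ∧
      LTI.matDeriv (Sum.inl k) (LTI.controllerForm n).B θ = 0 ∧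
      LTI.matDeriv (Sum.inl k) (LTI.controllerForm n).C θ = 0 ∧
      LTI.matDeriv (Sum.inr k) (LTI.controllerForm n).A θ = 0 ∧
      LTI.matDeriv (Sum.inr k) (LTI.controllerForm n).B θ = 0 ∧
      LTI.matDeriv (Sum.inr k) (LTI.controllerForm n).C θ
        = Matrix.of (fun _ j => if j = k then 1 else 0)) ∧
    -- the observer form: parameters `a_1, …, a_n, b_1, …, b_n`
    (∀ (n : ℕ) (θ : Fin n ⊕ Fin n → ℝ) (k : Fin n),
      LTI.matDeriv (Sum.inl k) (LTI.observerForm n).A θ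
        = Matrix.of (fun (i j : Fin n) => if (i : ℕ) + 1 = n ∧ j = k.rev then -1 else 0) ∧
      LTI.matDeriv (Sum.inl k) (LTI.observerForm n).B θ = 0 ∧
      LTI.matDeriv (Sum.inl k) (LTI.observerForm n).C θ = 0 ∧
      LTI.matDeriv (Sum.inr k) (LTI.observerForm n).A θ = 0 ∧
      LTI.matDeriv (Sum.inr k) (LTI.observerForm n).B θ
        = Matrix.of (fun (i : Fin n) _ => if i = k then 1 else 0) ∧
      LTI.matDeriv (Sum.inr k) (LTI.observerForm n).C θ = 0) := by
  refine ⟨?_, ?_, ?_⟩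
  · intro ι _ _ dx du dy Ω _ P _ M x0 w z h0 hw hz h T θ
    have hS := LTI.Model.posDef_innovCov h0 hw hz
    have hgrad := LTI.Model.hasGrad_logLikelihood h0 hw hz h (T := T) θ
    have hprob := LTI.Model.isProbabilityMeasure_outputLaw h T θ
    have hL2 : ∀ t : Fin T, MemLp (fun y => y t) 2 (M.outputLaw T P x0 w z θ) := fun t =>
      LTI.Model.memLp_output h T θ t (by simp)
    obtain ⟨hmem, hint⟩ := LTI.Model.memLp_and_integral_score h0 hw hz h θ T
    refine ⟨hS θ, LTI.Model.outputLaw_eq_withDensity h0 hw hz h T θ, fun y =>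
      ⟨LTI.Model.likelihood_pos h0 hw hz h θ y, LTI.Model.logLikelihood_eq h0 hw hz h θ y⟩,
      fun y => (hgrad y).1, fun i => ?_, fun t _ i j => ?_, ?_, fun t _ => ⟨?_, fun i =>
      (LTI.Model.hasMatGrad_innovCov h0 hw hz t).matDeriv_eq i, fun y =>
      ⟨(LTI.Model.hasVecGrad_innov h0 hw hz y t).differentiableAt, fun i k =>
      (LTI.Model.hasVecGrad_innov h0 hw hz y t).jacobian_apply k i⟩⟩, fun i c =>
      ⟨fun r s hr => ?_, fun r s hr => ?_, fun r s hr => ?_⟩⟩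
    · simp only [fun y => (hgrad y).2 i]
      exact hmem i
    · simp only [fun y => LTI.Model.infoTerm_apply h0 hw hz (M := M) (θ := θ) y t i j]
      exact LTI.Model.integrable_infoEntry hL2 _ _ _ i j t
    · ext i j
      rw [LTI.Model.fisherInformation, Matrix.of_apply, Matrix.sum_apply]
      simp only [fun y i => (hgrad y).2 i, Matrix.of_apply,
        fun y t => LTI.Model.infoTerm_apply h0 hw hz (M := M) (θ := θ) y t i j]
      exact hint i j
    · exact differentiableAt_pi.mpr fun k =>
        (LTI.Model.hasMatGrad_innovCov h0 hw hz t k.2 k.1).1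
    · exact (LTI.matDeriv_map_eval_apply M.entryA i r s).trans (by rw [hr, LTI.Entry.grad])
    · exact (LTI.matDeriv_map_eval_apply M.entryB i r s).trans (by rw [hr, LTI.Entry.grad])
    · exact (LTI.matDeriv_map_eval_apply M.entryC i r s).trans (by rw [hr, LTI.Entry.grad])
  · intro n θ k
    refine ⟨?_, ?_, ?_, ?_, ?_, ?_⟩ <;> ext r s
    · exact (LTI.matDeriv_map_eval_apply _ _ r s).trans (LTI.grad_companion_inl k r s)
    · refine (LTI.matDeriv_map_eval_apply _ _ r s).trans ?_
      simp only [LTI.controllerForm, Matrix.of_apply]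
      split_ifs <;> rfl
    · refine (LTI.matDeriv_map_eval_apply _ _ r s).trans ?_
      simp [LTI.controllerForm, LTI.Entry.grad]
    · exact (LTI.matDeriv_map_eval_apply _ _ r s).trans (LTI.grad_companion_inr k r s)
    · refine (LTI.matDeriv_map_eval_apply _ _ r s).trans ?_
      simp only [LTI.controllerForm, Matrix.of_apply]
      split_ifs <;> rfl
    · refine (LTI.matDeriv_map_eval_apply _ _ r s).trans ?_
      simp [LTI.controllerForm, LTI.Entry.grad, eq_comm]
  · intro n θ k
    refine ⟨?_, ?_, ?_, ?_, ?_, ?_⟩ <;> ext r s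
    · exact (LTI.matDeriv_map_eval_apply _ _ r s).trans (LTI.grad_companion_inl k r s)
    · refine (LTI.matDeriv_map_eval_apply _ _ r s).trans ?_
      simp [LTI.observerForm, LTI.Entry.grad]
    · refine (LTI.matDeriv_map_eval_apply _ _ r s).trans ?_
      simp only [LTI.observerForm, Matrix.of_apply]
      split_ifs <;> rfl
    · exact (LTI.matDeriv_map_eval_apply _ _ r s).trans (LTI.grad_companion_inr k r s)
    · refine (LTI.matDeriv_map_eval_apply _ _ r s).trans ?_
      simp [LTI.observerForm, LTI.Entry.grad, eq_comm]
    · refine (LTI.matDeriv_map_eval_apply _ _ r s).trans ?_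
      simp only [LTI.observerForm, Matrix.of_apply]
      split_ifs <;> rfl
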